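/- Let $\gamma>0$, $L>0$, $\sigma_0>0$, let $\mu\colon[0,1]\to\mathbb R$, and let $f\colon[0,1]\to\mathbb R$ be a Lipschitz continuous probability density with $0<f_{\min}\le f(t)\le f_{\max}<\infty$ for all $t\in[0,1]$. For $p\ge 1$ let the design points $x_1<\dots<x_p$ in $[0,1]$ be given by $\int_0^{x_j}f(t)\,\mathrm dt=\frac{j-1/2}{p}$, $j=1,\dots,p$. One observes $$Y_{i,j}=\mu(x_j)+Z_i(x_j)+\varepsilon_{i,j},\qquad i=1,\dots,n,\ j=1,\dots,p,$$ where $Z_1,\dots,Z_n$ are independent copies of a centered process $Z=(Z(x))_{x\in[0,1]}$ with covariance kernel $\Gamma(x,y)=\mathbb E[Z(x)Z(y)]$, and the errors $\varepsilon_{i,j}$ are i.i.d. $\mathcal N(0,\sigma_0^2)$ and independent of $Z_1,\dots,Z_n$. Let $T=\{(x,y)\in[0,1]^2 : x\le y\}$, let $k=\max\{m\in\mathbb N_0 : m<\gamma\}$, and let $\mathcal H_T(\gamma,L)$ be the class of functions $g\colon T\to\mathbb R$ with partial derivatives $D^\beta g$ on $T$ of all orders $|\beta|\le k$ such that $$\max_{|\beta|\le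 k}\sup_{w\in T}|D^\beta g(w)|+\max_{|\beta|=k}\ \sup_{v,w\in T,\,v\ne w}\frac{|D^\beta g(v)-D^\beta g(w)|}{\|v-w\|_\infty^{\gamma-k}}\le L .$$ Let $\mathcal P_{\mathcal G}(\gamma;L)$ be the class of all centered Gaussian processes $Z$ on $[0,1]$ with $\Gamma_{|T}\in\mathcal H_T(\gamma,L)$. Then, with $$a_{n,p}=p^{-\gamma}+\Big(\frac{\log(np)}{np}\Big)^{\frac{\gamma}{2\gamma+1}}+n^{-1/2},$$ it holds that $$\liminf_{n,p\to\infty}\ \inf_{\hat\Gamma_{n,p}}\ \sup_{Z\in\mathcal P_{\mathcal G}(\gamma;L)} a_{n,p}^{-1}\,\mathbb E\big[\|\hat\Gamma_{n,p}-\Gamma\|_\infty\big]>0,$$ where the infimum is taken over all estimators $\hat\Gamma_{n,p}$ of $\Gamma$ based on the observations $(Y_{i,j})$, and $\|\cdot\|_\infty$ is the supremum norm on $[0,1]^2$. -/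

import Mathlib

open MeasureTheory ProbabilityTheory Filter Set
open scoped NNReal ENNReal unitInterval

noncomputable section

namespace CovKernel

/-! ### Hölder classes on the upper triangle -/

/-- The closed upper triangle `T = {(x, y) ∈ [0,1]² | x ≤ y}`. The product `ℝ × ℝ` carries the
supremum norm. -/
def upperTriangle : Set (ℝ × ℝ) :=
  {w | 0 ≤ w.1 ∧ w.1 ≤ w.2 ∧ w.2 ≤ 1}

/-- The largest non-negative integer strictly smaller than `γ` (for `γ > 0`). -/
def holderOrder (γ : ℝ) : ℕ := ⌈γ⌉₊ - 1

/-- The mixed partial derivative `∂₁ ^ b₁ ∂₂ ^ b₂ F` at the point `w` of the triangle `T`, for a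
function `F` that is `b₁ + b₂` times continuously differentiable on `T`: the derivative of order
`b₁ + b₂` of `F` within `T`, evaluated at `b₁` copies of the first and `b₂` copies of the second
standard basis vector. For `w ∈ T` it only depends on the values of `F` on `T`. -/
def partialDeriv (b₁ b₂ : ℕ) (F : ℝ × ℝ → ℝ) (w : ℝ × ℝ) : ℝ :=
  iteratedFDerivWithin ℝ (b₁ + b₂) F upperTriangle w
    (fun i => if (i : ℕ) < b₁ then ((1 : ℝ), (0 : ℝ)) else ((0 : ℝ), (1 : ℝ)))

/-- The Hölder norm of order `γ` on the triangle `T`, with values in `[0, ∞]`. -/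
def holderNorm (γ : ℝ) (F : ℝ × ℝ → ℝ) : ℝ≥0∞ :=
  (⨆ (b : ℕ × ℕ) (_ : b.1 + b.2 ≤ holderOrder γ) (w ∈ upperTriangle),
      ENNReal.ofReal |partialDeriv b.1 b.2 F w|) +
  (⨆ (b : ℕ × ℕ) (_ : b.1 + b.2 = holderOrder γ)
      (v ∈ upperTriangle) (w ∈ upperTriangle) (_ : v ≠ w),
      ENNReal.ofReal (|partialDeriv b.1 b.2 F v - partialDeriv b.1 b.2 F w| /
        ‖v - w‖ ^ (γ - holderOrder γ)))

/-- The Hölder class `H_T(γ, L)` of functions on `T`: the partial derivatives up to the order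
`holderOrder γ` exist on `T` (up to the boundary) and the Hölder norm is at most `L`. A function
on `T` is represented by any extension to `ℝ × ℝ`; membership only depends on the values on `T`. -/
def holderClass (γ L : ℝ) : Set (ℝ × ℝ → ℝ) :=
  {F | ContDiffOn ℝ (holderOrder γ) F upperTriangle ∧ holderNorm γ F ≤ ENNReal.ofReal L}

/-! ### Random processes on `[0,1]` -/

/-- A real-valued random process with index set `[0,1]`, on some probability space. All
quantities below only depend on the finite-dimensional distributions of the process, so that
sample spaces in `Type` (such as the space of all paths) are enough. -/
structure RandomProcess where
  /-- the sample space -/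
  Ω : Type
  [mΩ : MeasurableSpace Ω]
  /-- the probability measure -/
  P : Measure Ω
  [isProb : IsProbabilityMeasure P]
  /-- the process -/
  Z : I → Ω → ℝ

attribute [instance] RandomProcess.mΩ RandomProcess.isProb

/-- The covariance kernel `Γ(x, y) = E[Z(x) Z(y)]` of a centered process. -/
def RandomProcess.kernel (X : RandomProcess) (x y : I) : ℝ :=
  ∫ ω, X.Z x ω * X.Z y ω ∂X.P

/-- A function on `[0,1]²`, extended to `ℝ × ℝ` by projecting both coordinates to `[0,1]`. -/
def extend (Γ : I → I → ℝ) (w : ℝ × ℝ) : ℝ :=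
  Γ (projIcc 0 1 zero_le_one w.1) (projIcc 0 1 zero_le_one w.2)

/-- The class of all centered Gaussian processes on `[0,1]` whose covariance kernel, restricted to
the triangle `T`, belongs to `H_T(γ, L)`. -/
def gaussianClass (γ L : ℝ) : Set RandomProcess :=
  {X | IsGaussianProcess X.Z X.P ∧ (∀ x, ∫ ω, X.Z x ω ∂X.P = 0) ∧
    extend X.kernel ∈ holderClass γ L}

/-! ### Design, observations and estimators -/

/-- `f` is (on `[0,1]`) a Lipschitz continuous probability density that is bounded away from zero
and infinity. -/
structure IsDesignDensity (f : ℝ → ℝ) : Prop where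
  lipschitz : ∃ K : ℝ≥0, LipschitzOnWith K f (Icc 0 1)
  bounds : ∃ fmin fmax : ℝ, 0 < fmin ∧ ∀ t ∈ Icc (0 : ℝ) 1, fmin ≤ f t ∧ f t ≤ fmax
  integral_eq_one : ∫ t in (0 : ℝ)..1, f t = 1

/-- The points `x 0, …, x (p - 1)` of `[0,1]` are the quantiles of the density `f` at the levels
`(j - 1/2) / p`, `j = 1, …, p`; the index of the points is shifted by one. -/
def IsDesign (f : ℝ → ℝ) {p : ℕ} (x : Fin p → I) : Prop :=
  ∀ j : Fin p, ∫ t in (0 : ℝ)..(x j : ℝ), f t = ((j : ℝ) + 1 / 2) / p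

/-- The joint distribution of `n` independent copies of the process (the first component) and of
`n * p` independent `N(0, σ₀²)` errors (the second component), independent of the copies. -/
def sampleMeasure (X : RandomProcess) (n p : ℕ) (σ₀ : ℝ≥0) :
    Measure ((Fin n → X.Ω) × (Fin n → Fin p → ℝ)) :=
  (Measure.pi fun _ : Fin n => X.P).prod
    (Measure.pi fun _ : Fin n => Measure.pi fun _ : Fin p => gaussianReal 0 (σ₀ ^ 2))

/-- The observations `Y i j = μ (x j) + Z i (x j) + ε i j`. -/
def observations (X : RandomProcess) {n p : ℕ} (μ : I → ℝ) (x : Fin p → I)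
    (s : (Fin n → X.Ω) × (Fin n → Fin p → ℝ)) : Fin n → Fin p → ℝ :=
  fun i j => μ (x j) + X.Z (x j) (s.1 i) + s.2 i j

/-- An estimator of the covariance kernel: a function of the observations with values in the
functions on `[0,1]²`, such that the estimate at each point of `[0,1]²` is measurable. -/
structure Estimator (n p : ℕ) where
  /-- the estimate, given the observations -/
  toFun : (Fin n → Fin p → ℝ) → I → I → ℝ
  measurable' : ∀ x y, Measurable fun Y => toFun Y x y

/-- The supremum norm distance of two functions on `[0,1]²`, with values in `[0, ∞]`. -/
def supDist (G H : I → I → ℝ) : ℝ≥0∞ :=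
  ⨆ (x : I) (y : I), ENNReal.ofReal |G x y - H x y|

/-- The risk `E ‖Γ̂ - Γ‖_∞` of an estimator when the process is `X`. The supremum over uncountably
many points need not be measurable; `∫⁻` is then the lower integral, the smallest reasonable
reading of the expectation, so that a lower bound for it is the strongest one. -/
def risk {n p : ℕ} (μ : I → ℝ) (σ₀ : ℝ≥0) (x : Fin p → I) (G : Estimator n p)
    (X : RandomProcess) : ℝ≥0∞ :=
  ∫⁻ s, supDist (G.toFun (observations X μ x s)) X.kernel ∂(sampleMeasure X n p σ₀)

/-- The rate `p ^ (-γ) + (log (n p) / (n p)) ^ (γ / (2 γ + 1)) + n ^ (-1/2)`. -/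
def rate (γ : ℝ) (n p : ℕ) : ℝ :=
  (p : ℝ) ^ (-γ) + (Real.log (n * p) / (n * p)) ^ (γ / (2 * γ + 1)) + (n : ℝ) ^ (-(1 / 2) : ℝ)

end CovKernel

end

/-!
All processes used in the lower bound have rank one, `Z x = g x * ω` with a standard normal `ω`, so
that the kernel is `g x * g y` and each observation row is `μ + g * ω i` plus noise. With a suitable
constant `A`, the reference process is `g₀ = A`. Each term of the rate comes from perturbing it in
a different way; the rate is at most three times its largest term.

* `n ^ (-1/2)` (`worstRisk_ge_sampling`): `g = A * r` with `r ^ 2 = 1 / (1 + u)`, `u = n ^ (-1/2)`.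
  This is a dilation of the latent variables `ω i`, whose likelihood ratio has second moment at most
  `exp (n * u ^ 2 / 2) ≤ 2`.
* `p ^ (-γ)` (`worstRisk_ge_discretization`): a bump at `0`, of width of the order `1 / p`,
  whose support contains no design point, leaves the observations unchanged.
* `(log (n * p) / (n * p)) ^ (γ / (2 * γ + 1))` (`worstRisk_ge_bandwidth`): one of many disjoint bumps
  `g k = A * (1 + h ^ γ * bump ((x - z k) / h))`. Given the latent variables, these are orthogonal
  shifts of the noise of energy of the order `n * p * h ^ (2 * γ + 1)`, hence of the order of the
  logarithm of their number for the right `h`. Conditioning on the latent variables and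
  a Markov bound for the sum of their squares avoid exponential moments of squared Gaussians, which
  need not exist when `p` is exponentially large compared with `n`. A window holds at most of
  the order of `p * h` design points if `p * h ≥ 1`; otherwise `h ^ γ ≤ p ^ (-γ)` and the previous bound suffices.

The comparison of hypotheses is `average_risk_ge`, a second moment bound for a mixture of
alternatives. It needs measurable losses, for which the errors at finitely many points of the
diagonal are enough. That the kernels belong to the Hölder class is `mem_holderClass_of_rescale`:
`h ^ γ * Ψ (h⁻¹ • w)` has a Hölder norm of order `γ` that is bounded uniformly in `h ≤ 1`.
-/

namespace CovKernel

/-! ### Product measures and likelihood ratios -/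

theorem lintegral_pi_prod {ι : Type*} [Fintype ι] {α : ι → Type*} [∀ i, MeasurableSpace (α i)]
    (μ : ∀ i, Measure (α i)) [∀ i, IsProbabilityMeasure (μ i)] {f : ∀ i, α i → ℝ≥0∞}
    (hf : ∀ i, Measurable (f i)) :
    ∫⁻ x, ∏ i, f i (x i) ∂Measure.pi μ = ∏ i, ∫⁻ y, f i y ∂μ i := by
  have h := lintegral_prod_eq_prod_lintegral_of_indepFun Finset.univ
    (fun i (x : ∀ i, α i) => f i (x i))
    (iIndepFun_pi (μ := μ) (X := f) fun i => (hf i).aemeasurable)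
    (fun i => (hf i).comp (measurable_pi_apply i))
  rw [h]
  refine Finset.prod_congr rfl fun i _ => ?_
  exact (measurePreserving_eval μ i).lintegral_comp (hf i)

/-- Likelihood ratios of transformed coordinates multiply. -/
theorem pi_map_eq_withDensity {ι : Type*} [Fintype ι] {α : ι → Type*}
    [∀ i, MeasurableSpace (α i)] (μ : ∀ i, Measure (α i)) [∀ i, IsProbabilityMeasure (μ i)]
    {T : ∀ i, α i → α i} (hT : ∀ i, Measurable (T i)) {f : ∀ i, α i → ℝ≥0∞}
    (hf : ∀ i, Measurable (f i)) (h : ∀ i, (μ i).map (T i) = (μ i).withDensity (f i)) :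
    (Measure.pi μ).map (fun x i => T i (x i)) =
      (Measure.pi μ).withDensity (fun x => ∏ i, f i (x i)) := by
  have hp : ∀ i, IsProbabilityMeasure ((μ i).map (T i)) := fun i =>
    Measure.isProbabilityMeasure_map (hT i).aemeasurable
  rw [Measure.pi_map_pi fun i => (hT i).aemeasurable]
  refine Measure.pi_eq fun s hs => ?_
  rw [withDensity_apply _ (MeasurableSet.univ_pi hs),
    ← lintegral_indicator (MeasurableSet.univ_pi hs)]
  have h1 : (Set.univ.pi s).indicator (fun x => ∏ i, f i (x i)) =
      fun x => ∏ i, (s i).indicator (f i) (x i) := by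
    ext x
    by_cases hx : x ∈ Set.univ.pi s
    · rw [Set.indicator_of_mem hx]
      exact Finset.prod_congr rfl fun i _ => (Set.indicator_of_mem (hx i trivial) _).symm
    · rw [Set.indicator_of_notMem hx]
      simp only [Set.mem_univ_pi, not_forall] at hx
      obtain ⟨i, hi⟩ := hx
      exact (Finset.prod_eq_zero (Finset.mem_univ i) (Set.indicator_of_notMem hi _)).symm
  rw [h1, lintegral_pi_prod μ fun i => (hf i).indicator (hs i)]
  refine Finset.prod_congr rfl fun i _ => ?_
  rw [h i, withDensity_apply _ (hs i), lintegral_indicator (hs i)]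

theorem lintegral_comp_of_map_eq_withDensity {α : Type*} [MeasurableSpace α] {μ : Measure α}
    {T : α → α} (hT : Measurable T) {f : α → ℝ} (hf : Measurable f)
    (h : μ.map T = μ.withDensity fun x => ENNReal.ofReal (f x)) {U : α → ℝ} (hU : Measurable U)
    (hU0 : ∀ x, 0 ≤ U x) :
    ∫⁻ x, ENNReal.ofReal (U (T x)) ∂μ = ∫⁻ x, ENNReal.ofReal (U x * f x) ∂μ := by
  rw [← lintegral_map (f := fun x => ENNReal.ofReal (U x)) hU.ennreal_ofReal hT, h,
    lintegral_withDensity_eq_lintegral_mul _ hf.ennreal_ofReal hU.ennreal_ofReal]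
  refine lintegral_congr fun x => ?_
  rw [ENNReal.ofReal_mul (hU0 x), mul_comm, Pi.mul_apply]

/-- A testing bound: if the losses `U₀` and `U k` always add up to at least `δ`, and if the average
of the likelihood ratios `l k` has second moment at most `2` under the null hypothesis `P`, then the
risk under the null hypothesis plus the average risk under the alternatives is at least `δ / 2`
(multiplied here by the number of alternatives). With `s` the averaged likelihood ratio, the sum of
the losses, weighted with the densities, is at least `δ * min 1 s ≥ δ * (s - s ^ 2 / 4)`. -/
theorem average_risk_ge {Ω ι : Type*} [MeasurableSpace Ω] [Fintype ι] [Nonempty ι]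
    (P : Measure Ω) {l : ι → Ω → ℝ} (hlm : ∀ k, Measurable (l k)) (hl0 : ∀ k ω, 0 ≤ l k ω)
    (hl1 : ∀ k, ∫⁻ ω, ENNReal.ofReal (l k ω) ∂P = 1) {U₀ : Ω → ℝ} {U : ι → Ω → ℝ}
    (hU₀m : Measurable U₀) (hUm : ∀ k, Measurable (U k)) (hU₀ : ∀ ω, 0 ≤ U₀ ω)
    (hU : ∀ k ω, 0 ≤ U k ω) {δ : ℝ} (hδ : 0 ≤ δ) (hsep : ∀ k ω, δ ≤ U₀ ω + U k ω)
    (hl2 : ∫⁻ ω, ENNReal.ofReal ((∑ k, l k ω) ^ 2) ∂P ≤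
      ENNReal.ofReal (2 * (Fintype.card ι : ℝ) ^ 2)) :
    ENNReal.ofReal (Fintype.card ι * (δ / 2)) ≤
      Fintype.card ι * ∫⁻ ω, ENNReal.ofReal (U₀ ω) ∂P +
        ∑ k, ∫⁻ ω, ENNReal.ofReal (U k ω * l k ω) ∂P := by
  set m : ℝ := (Fintype.card ι : ℝ) with hm
  have hmpos : 0 < m := by rw [hm]; exact_mod_cast Fintype.card_pos
  -- With `s = S / m`, this is `δ * s ≤ U₀ + average of U k * l k + δ * s ^ 2 / 4`, times `m`.
  have hpt : ∀ ω, δ * ∑ k, l k ω ≤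
      m * U₀ ω + ∑ k, U k ω * l k ω + δ / (4 * m) * (∑ k, l k ω) ^ 2 := by
    intro ω
    set S := ∑ k, l k ω with hS
    have hS0 : 0 ≤ S := Finset.sum_nonneg fun k _ => hl0 k ω
    have hsq : δ * S ≤ m * δ + δ / (4 * m) * S ^ 2 := by
      have : m * δ + δ / (4 * m) * S ^ 2 - δ * S = δ / (4 * m) * (S - 2 * m) ^ 2 := by
        field_simp; ring
      have h2 : 0 ≤ δ / (4 * m) * (S - 2 * m) ^ 2 := by positivity
      linarith
    have hsum0 : 0 ≤ ∑ k, U k ω * l k ω :=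
      Finset.sum_nonneg fun k _ => mul_nonneg (hU k ω) (hl0 k ω)
    have hsum : (δ - U₀ ω) * S ≤ ∑ k, U k ω * l k ω := by
      rw [hS, Finset.mul_sum]
      exact Finset.sum_le_sum fun k _ =>
        mul_le_mul_of_nonneg_right (by linarith [hsep k ω]) (hl0 k ω)
    have hq0 : 0 ≤ δ / (4 * m) * S ^ 2 := by positivity
    rcases le_total δ (U₀ ω) with h | h
    · nlinarith [mul_le_mul_of_nonneg_left h hmpos.le]
    · rcases le_total S m with h' | h'
      · nlinarith [mul_le_mul_of_nonneg_left h' (hU₀ ω)]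
      · nlinarith [mul_le_mul_of_nonneg_left h' (sub_nonneg.2 h)]
  have hSm : Measurable fun ω => ∑ k, l k ω := Finset.measurable_sum _ fun k _ => hlm k
  have hint : ENNReal.ofReal (m * δ) ≤
      ((Fintype.card ι : ℝ≥0∞) * ∫⁻ ω, ENNReal.ofReal (U₀ ω) ∂P +
        ∑ k, ∫⁻ ω, ENNReal.ofReal (U k ω * l k ω) ∂P) + ENNReal.ofReal (m * (δ / 2)) := by
    calc ENNReal.ofReal (m * δ) = ∫⁻ ω, ENNReal.ofReal (δ * ∑ k, l k ω) ∂P := by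
          simp_rw [ENNReal.ofReal_mul hδ]
          rw [lintegral_const_mul _ hSm.ennreal_ofReal]
          simp_rw [ENNReal.ofReal_sum_of_nonneg fun k _ => hl0 k _]
          rw [lintegral_finsetSum _ fun k _ => (hlm k).ennreal_ofReal]
          rw [mul_comm m, ENNReal.ofReal_mul hδ]
          simp [hl1, hm]
      _ ≤ ∫⁻ ω, ((ENNReal.ofReal m * ENNReal.ofReal (U₀ ω) +
            ∑ k, ENNReal.ofReal (U k ω * l k ω)) +
            ENNReal.ofReal (δ / (4 * m)) * ENNReal.ofReal ((∑ k, l k ω) ^ 2)) ∂P := by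
          refine lintegral_mono fun ω => (ENNReal.ofReal_le_ofReal (hpt ω)).trans ?_
          refine ENNReal.ofReal_add_le.trans ?_
          rw [ENNReal.ofReal_mul (by positivity : 0 ≤ δ / (4 * m))]
          gcongr
          refine ENNReal.ofReal_add_le.trans ?_
          rw [ENNReal.ofReal_mul hmpos.le,
            ENNReal.ofReal_sum_of_nonneg fun k _ => mul_nonneg (hU k ω) (hl0 k ω)]
      _ = (Fintype.card ι * ∫⁻ ω, ENNReal.ofReal (U₀ ω) ∂P +
            ∑ k, ∫⁻ ω, ENNReal.ofReal (U k ω * l k ω) ∂P) + ENNReal.ofReal (δ / (4 * m)) *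
            ∫⁻ ω, ENNReal.ofReal ((∑ k, l k ω) ^ 2) ∂P := by
          rw [lintegral_add_right _ ((hSm.pow_const 2).ennreal_ofReal.const_mul _),
            lintegral_add_left (hU₀m.ennreal_ofReal.const_mul _),
            lintegral_const_mul _ hU₀m.ennreal_ofReal,
            lintegral_const_mul _ (hSm.pow_const 2).ennreal_ofReal,
            lintegral_finsetSum Finset.univ (f := fun k ω => ENNReal.ofReal (U k ω * l k ω))
              fun k _ => ((hUm k).mul (hlm k)).ennreal_ofReal]
          simp [hm]
      _ ≤ _ := by
          gcongr
          refine (mul_le_mul_right hl2 _).trans ?_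
          rw [← ENNReal.ofReal_mul (by positivity)]
          refine ENNReal.ofReal_le_ofReal (le_of_eq ?_)
          field_simp; ring
  have hhalf : ENNReal.ofReal (m * δ) =
      ENNReal.ofReal (m * (δ / 2)) + ENNReal.ofReal (m * (δ / 2)) := by
    rw [← ENNReal.ofReal_add (by positivity) (by positivity)]
    congr 1; ring
  rw [hhalf] at hint
  exact (ENNReal.add_le_add_iff_right ENNReal.ofReal_ne_top).1 hint

/-! ### Gaussian shifts and dilations -/

theorem gaussianReal_map_add_eq_withDensity {v : ℝ≥0} (hv : v ≠ 0) (θ : ℝ) :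
    (gaussianReal 0 v).map (· + θ) =
      (gaussianReal 0 v).withDensity
        (fun x => ENNReal.ofReal (Real.exp ((θ * x - θ ^ 2 / 2) / v))) := by
  have hv' : (v : ℝ) ≠ 0 := by exact_mod_cast hv
  rw [gaussianReal_map_add_const, zero_add, gaussianReal_of_var_ne_zero _ hv,
    gaussianReal_of_var_ne_zero _ hv,
    ← withDensity_mul _ (measurable_gaussianPDF _ _) (by fun_prop)]
  congr 1
  ext x
  rw [Pi.mul_apply, gaussianPDF, gaussianPDF, ← ENNReal.ofReal_mul (gaussianPDFReal_nonneg _ _ _),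
    gaussianPDFReal, gaussianPDFReal, mul_assoc _ (Real.exp _), ← Real.exp_add]
  congr 3
  field_simp
  ring

/-- The likelihood ratio of `N(0, (1 + u)⁻¹)` with respect to `N(0, 1)`. -/
noncomputable def dilationRatio (u x : ℝ) : ℝ :=
  √(1 + u) * Real.exp (-(u * x ^ 2) / 2)

theorem measurable_dilationRatio (u : ℝ) : Measurable (dilationRatio u) := by
  unfold dilationRatio; fun_prop

theorem dilationRatio_nonneg (u x : ℝ) : 0 ≤ dilationRatio u x := by
  unfold dilationRatio; positivity

theorem gaussianPDFReal_eq_mul_dilationRatio {u : ℝ} (hu : 0 ≤ u) (x : ℝ) :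
    gaussianPDFReal 0 (Real.toNNReal (1 + u)⁻¹) x =
      gaussianPDFReal 0 1 x * dilationRatio u x := by
  have h1 : 0 < 1 + u := by linarith
  rw [gaussianPDFReal, gaussianPDFReal, dilationRatio, Real.coe_toNNReal _ (by positivity),
    mul_mul_mul_comm, ← Real.exp_add]
  congr 1
  · rw [Real.sqrt_mul (by positivity), Real.sqrt_inv, mul_inv, inv_inv, NNReal.coe_one, mul_one]
  · congr 1
    rw [NNReal.coe_one]
    field_simp
    ring

/-- Multiplication by `(1 + u) ^ (-1/2)` turns `N(0, 1)` into `N(0, (1 + u)⁻¹)`. -/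
theorem gaussianReal_map_mul_eq_withDensity {u : ℝ} (hu : 0 ≤ u) :
    (gaussianReal 0 1).map ((√(1 + u))⁻¹ * ·) =
      (gaussianReal 0 1).withDensity (fun x => ENNReal.ofReal (dilationRatio u x)) := by
  have h1 : 0 < 1 + u := by linarith
  have hv : (NNReal.mk (((√(1 + u))⁻¹) ^ 2) (sq_nonneg _) * 1 : ℝ≥0) =
      Real.toNNReal (1 + u)⁻¹ := by
    ext
    rw [Real.coe_toNNReal _ (by positivity), mul_one, NNReal.coe_mk, inv_pow,
      Real.sq_sqrt h1.le]
  have hv0 : Real.toNNReal (1 + u)⁻¹ ≠ 0 := by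
    rw [Ne, Real.toNNReal_eq_zero, not_le]; positivity
  rw [gaussianReal_map_const_mul, mul_zero, hv, gaussianReal_of_var_ne_zero _ hv0,
    gaussianReal_of_var_ne_zero _ one_ne_zero,
    ← withDensity_mul _ (measurable_gaussianPDF _ _) (measurable_dilationRatio u).ennreal_ofReal]
  congr 1
  ext x
  rw [Pi.mul_apply, gaussianPDF, gaussianPDF, gaussianPDFReal_eq_mul_dilationRatio hu,
    ENNReal.ofReal_mul (gaussianPDFReal_nonneg _ _ _)]

theorem lintegral_dilationRatio {u : ℝ} (hu : 0 ≤ u) :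
    ∫⁻ x, ENNReal.ofReal (dilationRatio u x) ∂gaussianReal 0 1 = 1 := by
  have : IsProbabilityMeasure ((gaussianReal 0 1).map ((√(1 + u))⁻¹ * ·)) :=
    Measure.isProbabilityMeasure_map (by fun_prop)
  rw [gaussianReal_map_mul_eq_withDensity hu] at this
  have h := this.measure_univ
  rwa [withDensity_apply _ MeasurableSet.univ, Measure.restrict_univ] at h

/-- The square of a likelihood ratio is again a likelihood ratio up to a constant, which is therefore
its second moment. -/
theorem dilationRatio_sq {u : ℝ} (hu : 0 ≤ u) (x : ℝ) :
    dilationRatio u x ^ 2 = (1 + u) / √(1 + 2 * u) * dilationRatio (2 * u) x := by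
  have h1 : 0 < √(1 + 2 * u) := Real.sqrt_pos.2 (by linarith)
  rw [dilationRatio, dilationRatio, mul_pow, Real.sq_sqrt (by linarith), ← mul_assoc,
    div_mul_cancel₀ _ h1.ne', sq, ← Real.exp_add]
  congr 2
  ring

theorem lintegral_dilationRatio_sq_le {u : ℝ} (hu : 0 ≤ u) :
    ∫⁻ x, ENNReal.ofReal (dilationRatio u x ^ 2) ∂gaussianReal 0 1 ≤
      ENNReal.ofReal (Real.exp (u ^ 2 / 2)) := by
  have h1 : 0 < √(1 + 2 * u) := Real.sqrt_pos.2 (by linarith)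
  simp_rw [dilationRatio_sq hu, ENNReal.ofReal_mul (by positivity : 0 ≤ (1 + u) / √(1 + 2 * u))]
  rw [lintegral_const_mul _ (measurable_dilationRatio _).ennreal_ofReal,
    lintegral_dilationRatio (by linarith), mul_one]
  refine ENNReal.ofReal_le_ofReal ?_
  rw [div_le_iff₀ h1]
  have h2 : (1 + u) ^ 2 ≤ (Real.exp (u ^ 2 / 2) * √(1 + 2 * u)) ^ 2 := by
    rw [mul_pow, Real.sq_sqrt (by linarith), sq (Real.exp _), ← Real.exp_add, add_halves]
    nlinarith [mul_le_mul_of_nonneg_right (Real.add_one_le_exp (u ^ 2))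
      (by linarith : 0 ≤ 1 + 2 * u), mul_nonneg hu (sq_nonneg u)]
  exact (abs_le_of_sq_le_sq' h2 (by positivity)).2

/-- The law of an `n × p` matrix of independent `N(0, v)` errors. -/
noncomputable def noise (n p : ℕ) (v : ℝ≥0) : Measure (Fin n → Fin p → ℝ) :=
  Measure.pi fun _ : Fin n => Measure.pi fun _ : Fin p => gaussianReal 0 v

instance (n p : ℕ) (v : ℝ≥0) : IsProbabilityMeasure (noise n p v) := by
  unfold noise; infer_instance

/-- The likelihood ratio of the law of `ε + θ` with respect to the law of `ε`, when `ε` is a matrix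
of independent `N(0, v)` errors. -/
noncomputable def shiftRatio {n p : ℕ} (v : ℝ≥0) (θ ε : Fin n → Fin p → ℝ) : ℝ :=
  Real.exp (∑ i, ∑ j, (θ i j * ε i j - θ i j ^ 2 / 2) / v)

theorem shiftRatio_nonneg {n p : ℕ} (v : ℝ≥0) (θ ε : Fin n → Fin p → ℝ) :
    0 ≤ shiftRatio v θ ε := (Real.exp_pos _).le

theorem measurable_shiftRatio {n p : ℕ} (v : ℝ≥0) (θ : Fin n → Fin p → ℝ) :
    Measurable (shiftRatio v θ) := by
  unfold shiftRatio; fun_prop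

theorem noise_map_add {n p : ℕ} {v : ℝ≥0} (hv : v ≠ 0) (θ : Fin n → Fin p → ℝ) :
    (noise n p v).map (· + θ) =
      (noise n p v).withDensity fun ε => ENNReal.ofReal (shiftRatio v θ ε) := by
  have h1 : ∀ i, (Measure.pi fun _ : Fin p => gaussianReal 0 v).map (fun x j => x j + θ i j) =
      (Measure.pi fun _ : Fin p => gaussianReal 0 v).withDensity fun x =>
        ∏ j, ENNReal.ofReal (Real.exp ((θ i j * x j - θ i j ^ 2 / 2) / v)) := fun i =>
    pi_map_eq_withDensity (T := fun j x => x + θ i j)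
      (f := fun j x => ENNReal.ofReal (Real.exp ((θ i j * x - θ i j ^ 2 / 2) / v)))
      (fun _ : Fin p => gaussianReal 0 v) (fun j => by fun_prop)
      (fun j => by fun_prop) (fun j => gaussianReal_map_add_eq_withDensity hv (θ i j))
  have h2 := pi_map_eq_withDensity (fun _ : Fin n => Measure.pi fun _ : Fin p => gaussianReal 0 v)
    (T := fun i x j => x j + θ i j)
    (f := fun i x => ∏ j, ENNReal.ofReal (Real.exp ((θ i j * x j - θ i j ^ 2 / 2) / v)))
    (fun i => by fun_prop) (fun i => by fun_prop) h1
  have h3 : (fun ε => ENNReal.ofReal (shiftRatio v θ ε)) =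
      fun ε => ∏ i, ∏ j, ENNReal.ofReal (Real.exp ((θ i j * ε i j - θ i j ^ 2 / 2) / v)) := by
    ext ε
    rw [shiftRatio, Real.exp_sum, ENNReal.ofReal_prod_of_nonneg fun i _ => (Real.exp_pos _).le]
    refine Finset.prod_congr rfl fun i _ => ?_
    rw [Real.exp_sum, ENNReal.ofReal_prod_of_nonneg fun i _ => (Real.exp_pos _).le]
  rw [h3]
  exact h2

theorem lintegral_shiftRatio {n p : ℕ} {v : ℝ≥0} (hv : v ≠ 0) (θ : Fin n → Fin p → ℝ) :
    ∫⁻ ε, ENNReal.ofReal (shiftRatio v θ ε) ∂noise n p v = 1 := by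
  have : IsProbabilityMeasure ((noise n p v).map (· + θ)) :=
    Measure.isProbabilityMeasure_map (by fun_prop)
  rw [noise_map_add hv] at this
  have h := this.measure_univ
  rwa [withDensity_apply _ MeasurableSet.univ, Measure.restrict_univ] at h

theorem lintegral_shiftRatio_mul {n p : ℕ} {v : ℝ≥0} (hv : v ≠ 0) (θ θ' : Fin n → Fin p → ℝ) :
    ∫⁻ ε, ENNReal.ofReal (shiftRatio v θ ε * shiftRatio v θ' ε) ∂noise n p v =
      ENNReal.ofReal (Real.exp ((∑ i, ∑ j, θ i j * θ' i j) / v)) := by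
  have h : ∀ ε, shiftRatio v θ ε * shiftRatio v θ' ε =
      Real.exp ((∑ i, ∑ j, θ i j * θ' i j) / v) * shiftRatio v (θ + θ') ε := by
    intro ε
    simp only [shiftRatio, ← Real.exp_add, Finset.sum_div, ← Finset.sum_add_distrib, Pi.add_apply]
    congr 1
    refine Finset.sum_congr rfl fun i _ => Finset.sum_congr rfl fun j _ => ?_
    ring
  simp_rw [h, ENNReal.ofReal_mul (Real.exp_pos _).le]
  rw [lintegral_const_mul, lintegral_shiftRatio hv, mul_one]
  exact (measurable_shiftRatio v _).ennreal_ofReal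

/-! ### Hölder norms of rescaled functions -/

theorem uniqueDiffOn_upperTriangle : UniqueDiffOn ℝ upperTriangle := by
  refine uniqueDiffOn_convex ?_ ?_
  · rintro u ⟨hu1, hu2, hu3⟩ v ⟨hv1, hv2, hv3⟩ a b ha hb hab
    simp only [upperTriangle, mem_ofPred_eq, Prod.fst_add, Prod.snd_add, Prod.smul_fst,
      Prod.smul_snd, smul_eq_mul]
    refine ⟨by positivity, by gcongr, ?_⟩
    nlinarith
  · refine ⟨(1 / 4, 3 / 4), mem_interior.2
      ⟨{w | 0 < w.1 ∧ w.1 < w.2 ∧ w.2 < 1}, fun w hw => ⟨hw.1.le, hw.2.1.le, hw.2.2.le⟩, ?_, ?_⟩⟩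
    · exact (isOpen_lt continuous_const continuous_fst).inter
        ((isOpen_lt continuous_fst continuous_snd).inter
          (isOpen_lt continuous_snd continuous_const))
    · norm_num

theorem holderOrder_lt {γ : ℝ} (hγ : 0 < γ) : (holderOrder γ : ℝ) < γ := by
  have h : 0 < ⌈γ⌉₊ := Nat.ceil_pos.2 hγ
  exact Nat.lt_ceil.1 (by unfold holderOrder; omega)

theorem le_holderOrder_add_one {γ : ℝ} : γ ≤ holderOrder γ + 1 := by
  refine (Nat.le_ceil γ).trans ?_
  unfold holderOrder
  exact_mod_cast (by omega : ⌈γ⌉₊ ≤ ⌈γ⌉₊ - 1 + 1)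

/-- The coordinate directions along which `partialDeriv` evaluates the derivative. -/
noncomputable def coordDirections (b₁ b₂ : ℕ) : Fin (b₁ + b₂) → ℝ × ℝ :=
  fun i => if (i : ℕ) < b₁ then ((1 : ℝ), (0 : ℝ)) else ((0 : ℝ), (1 : ℝ))

theorem norm_coordDirections_le (b₁ b₂ : ℕ) : ‖coordDirections b₁ b₂‖ ≤ 1 := by
  refine (pi_norm_le_iff_of_nonneg zero_le_one).2 fun i => ?_
  unfold coordDirections
  split_ifs <;> simp [Prod.norm_def]

theorem partialDeriv_eq {F G : ℝ × ℝ → ℝ} {b₁ b₂ : ℕ} (hG : ContDiff ℝ (b₁ + b₂ : ℕ) G)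
    (hFG : EqOn F G upperTriangle) {w : ℝ × ℝ} (hw : w ∈ upperTriangle) :
    partialDeriv b₁ b₂ F w = iteratedFDeriv ℝ (b₁ + b₂) G w (coordDirections b₁ b₂) := by
  rw [partialDeriv, iteratedFDerivWithin_congr hFG hw,
    iteratedFDerivWithin_eq_iteratedFDeriv uniqueDiffOn_upperTriangle hG.contDiffAt hw]
  rfl

theorem norm_iteratedFDeriv_const_le (a : ℝ) (j : ℕ) (w : ℝ × ℝ) :
    ‖iteratedFDeriv ℝ j (fun _ : ℝ × ℝ => a) w‖ ≤ |a| := by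
  rcases Nat.eq_zero_or_pos j with rfl | hj
  · rw [norm_iteratedFDeriv_zero, Real.norm_eq_abs]
  · rw [iteratedFDeriv_const_of_ne hj.ne']
    simp

theorem iteratedFDeriv_rescale {Ψ : ℝ × ℝ → ℝ} {N : ℕ} (hΨ : ContDiff ℝ N Ψ) (a c s : ℝ)
    (w₀ w : ℝ × ℝ) {j : ℕ} (hj : j ≤ N) :
    iteratedFDeriv ℝ j (fun w => a + c * Ψ (s • (w - w₀))) w =
      iteratedFDeriv ℝ j (fun _ : ℝ × ℝ => a) w +
        (c * s ^ j) • iteratedFDeriv ℝ j Ψ (s • (w - w₀)) := by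
  have hj' : ContDiff ℝ j Ψ := hΨ.of_le (by exact_mod_cast hj)
  have h1 : ContDiff ℝ j fun w : ℝ × ℝ => Ψ (s • (w - w₀)) := by fun_prop
  have h2 : iteratedFDeriv ℝ j (fun w : ℝ × ℝ => Ψ (s • (w - w₀))) w =
      s ^ j • iteratedFDeriv ℝ j Ψ (s • (w - w₀)) := by
    rw [iteratedFDeriv_comp_sub' (f := fun z : ℝ × ℝ => Ψ (s • z)) j w₀,
      iteratedFDeriv_comp_const_smul s hj']
  have h3 : (fun w : ℝ × ℝ => a + c * Ψ (s • (w - w₀))) =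
      (fun _ => a) + c • fun w : ℝ × ℝ => Ψ (s • (w - w₀)) := rfl
  have h4 : ContDiffAt ℝ j (c • fun w : ℝ × ℝ => Ψ (s • (w - w₀))) w :=
    h1.contDiffAt.const_smul c
  rw [h3, iteratedFDeriv_add_apply contDiffAt_const h4,
    iteratedFDeriv_const_smul_apply h1.contDiffAt, h2, smul_smul]

/-- Rescaling the argument by `h` and the values by `h ^ γ` does not increase the Hölder norm of
order `γ`, up to constants: the derivatives of order `j ≤ k < γ` are multiplied by `h ^ (γ - j)`,
and the increments of those of order `k` are interpolated between the bounds `2 * M` and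
`M * ‖v - w‖ / h`. -/
theorem mem_holderClass_of_rescale {γ : ℝ} (hγ : 0 < γ) {Ψ : ℝ × ℝ → ℝ}
    (hΨ : ContDiff ℝ (holderOrder γ + 1 : ℕ) Ψ) {M : ℝ}
    (hM : ∀ j ≤ holderOrder γ + 1, ∀ w, ‖iteratedFDeriv ℝ j Ψ w‖ ≤ M) {h : ℝ} (h0 : 0 < h)
    (h1 : h ≤ 1) (a : ℝ) (w₀ : ℝ × ℝ) {F : ℝ × ℝ → ℝ} {L : ℝ} (hL : |a| + 3 * M ≤ L)
    (hF : ∀ w ∈ upperTriangle, F w = a + h ^ γ * Ψ (h⁻¹ • (w - w₀))) :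
    F ∈ holderClass γ L := by
  set k := holderOrder γ with hk
  have hkγ : (k : ℝ) < γ := holderOrder_lt hγ
  have hγk : γ ≤ k + 1 := le_holderOrder_add_one
  have hM0 : 0 ≤ M := (norm_nonneg _).trans (hM 0 (by omega) 0)
  set G : ℝ × ℝ → ℝ := fun w => a + h ^ γ * Ψ (h⁻¹ • (w - w₀)) with hG
  have hGc : ContDiff ℝ (k + 1 : ℕ) G := by fun_prop
  have hGj : ∀ {j : ℕ}, j ≤ k → ContDiff ℝ j G := fun hj =>
    hGc.of_le (by exact_mod_cast hj.trans (Nat.le_succ k))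
  have hscale : ∀ j : ℕ, h ^ γ * h⁻¹ ^ j = h ^ (γ - j) := fun j => by
    rw [Real.rpow_sub h0, Real.rpow_natCast, inv_pow, div_eq_mul_inv]
  have hval : ∀ b : ℕ × ℕ, b.1 + b.2 ≤ k → ∀ w ∈ upperTriangle,
      |partialDeriv b.1 b.2 F w| ≤ |a| + M := by
    intro b hb w hw
    rw [partialDeriv_eq (hGj hb) hF hw, ← Real.norm_eq_abs]
    refine (ContinuousMultilinearMap.unit_le_opNorm _ (norm_coordDirections_le _ _)).trans ?_
    rw [hG, iteratedFDeriv_rescale hΨ _ _ _ _ _ (by omega), hscale]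
    refine (norm_add_le _ _).trans (add_le_add (norm_iteratedFDeriv_const_le _ _ _) ?_)
    rw [norm_smul, Real.norm_of_nonneg (by positivity)]
    have hle : h ^ (γ - ((b.1 + b.2 : ℕ) : ℝ)) ≤ 1 := by
      refine Real.rpow_le_one h0.le h1 (sub_nonneg.2 (le_trans ?_ hkγ.le))
      exact_mod_cast hb
    calc _ ≤ 1 * M := by
          gcongr
          exact hM _ (by omega) _
      _ = M := one_mul M
  have hlip : ∀ u u' : ℝ × ℝ, ‖iteratedFDeriv ℝ k Ψ u - iteratedFDeriv ℝ k Ψ u'‖ ≤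
      M * ‖u - u'‖ := fun u u' =>
    convex_univ.norm_image_sub_le_of_norm_fderiv_le (𝕜 := ℝ)
      (fun x _ => (hΨ.differentiable_iteratedFDeriv (by exact_mod_cast Nat.lt_succ_self k)) x)
      (fun x _ => by rw [norm_fderiv_iteratedFDeriv]; exact hM _ le_rfl x) (mem_univ _)
      (mem_univ _)
  have hincr : ∀ b : ℕ × ℕ, b.1 + b.2 = k → ∀ v ∈ upperTriangle, ∀ w ∈ upperTriangle, v ≠ w →
      |partialDeriv b.1 b.2 F v - partialDeriv b.1 b.2 F w| / ‖v - w‖ ^ (γ - k) ≤ 2 * M := by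
    intro b hb v hv w hw hvw
    have hpos : 0 < ‖v - w‖ := norm_sub_pos_iff.2 hvw
    rw [partialDeriv_eq (hGj hb.le) hF hv, partialDeriv_eq (hGj hb.le) hF hw,
      div_le_iff₀ (by positivity), ← sub_apply, ← Real.norm_eq_abs]
    refine (ContinuousMultilinearMap.unit_le_opNorm _ (norm_coordDirections_le _ _)).trans ?_
    rw [hG, iteratedFDeriv_rescale hΨ _ _ _ _ _ (by omega),
      iteratedFDeriv_rescale hΨ _ _ _ _ _ (by omega), hscale]
    have hc : iteratedFDeriv ℝ (b.1 + b.2) (fun _ : ℝ × ℝ => a) v =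
        iteratedFDeriv ℝ (b.1 + b.2) (fun _ : ℝ × ℝ => a) w := by
      rcases Nat.eq_zero_or_pos (b.1 + b.2) with h' | h'
      · rw [h']; ext; simp
      · rw [iteratedFDeriv_const_of_ne h'.ne']; rfl
    rw [hc, add_sub_add_left_eq_sub, ← smul_sub, norm_smul, Real.norm_of_nonneg (by positivity),
      hb]
    set t : ℝ := ‖v - w‖ / h with ht
    have ht0 : 0 < t := by positivity
    have hsplit : ‖v - w‖ ^ (γ - k) = h ^ (γ - k) * t ^ (γ - k) := by
      rw [← Real.mul_rpow h0.le ht0.le, ht, mul_div_cancel₀ _ h0.ne']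
    have hD : ‖iteratedFDeriv ℝ k Ψ (h⁻¹ • (v - w₀)) - iteratedFDeriv ℝ k Ψ (h⁻¹ • (w - w₀))‖ ≤
        2 * M * t ^ (γ - k) := by
      rcases le_total t 1 with ht1 | ht1
      · refine (hlip _ _).trans ?_
        rw [← smul_sub, sub_sub_sub_cancel_right, norm_smul, Real.norm_of_nonneg (by positivity),
          inv_mul_eq_div, ← ht]
        have : t ^ (1 : ℝ) ≤ t ^ (γ - k) :=
          Real.rpow_le_rpow_of_exponent_ge ht0 ht1 (by linarith)
        rw [Real.rpow_one] at this
        nlinarith [mul_le_mul_of_nonneg_left this hM0, mul_nonneg hM0 ht0.le]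
      · refine (norm_sub_le _ _).trans ?_
        have : 1 ≤ t ^ (γ - k) := Real.one_le_rpow ht1 (by linarith)
        nlinarith [hM k (by omega) (h⁻¹ • (v - w₀)), hM k (by omega) (h⁻¹ • (w - w₀)),
          mul_le_mul_of_nonneg_left this hM0]
    rw [hsplit]
    calc _ ≤ h ^ (γ - k) * (2 * M * t ^ (γ - k)) := by gcongr
      _ = _ := by ring
  refine ⟨(hGc.of_le (by exact_mod_cast Nat.le_succ k)).contDiffOn.congr hF, ?_⟩
  refine le_trans ?_ (ENNReal.ofReal_le_ofReal hL)
  have hsum : ENNReal.ofReal (|a| + 3 * M) =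
      ENNReal.ofReal (|a| + M) + ENNReal.ofReal (2 * M) := by
    rw [← ENNReal.ofReal_add (by positivity) (by positivity)]
    congr 1; ring
  rw [hsum]
  refine add_le_add ?_ ?_
  · exact iSup₂_le fun b hb => iSup₂_le fun w hw => ENNReal.ofReal_le_ofReal (hval b hb w hw)
  · exact iSup₂_le fun b hb => iSup₂_le fun v hv => iSup₂_le fun w hw => iSup_le fun hvw =>
      ENNReal.ofReal_le_ofReal (hincr b hb v hv w hw hvw)

/-! ### Kernels of rank one with a bump -/

/-- A smooth bump on `ℝ` with values in `[0, 1]` and support `(-1, 1)`, equal to `1` at `0`. -/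
noncomputable def bump : ContDiffBump (0 : ℝ) := ⟨1 / 2, 1, by norm_num, by norm_num⟩

theorem bump_zero : bump 0 = 1 :=
  bump.one_of_mem_closedBall (Metric.mem_closedBall_self bump.rIn_pos.le)

theorem bump_eq_zero {t : ℝ} (ht : 1 ≤ |t|) : bump t = 0 := by
  refine bump.zero_of_le_dist ?_
  rw [Real.dist_0_eq_abs]
  exact ht

/-- The nonconstant part, up to the factor `h ^ γ`, of the kernel
`(1 + h ^ γ * bump x) * (1 + h ^ γ * bump y)`, with `c = h ^ γ`. -/
noncomputable def bumpKernel (c : ℝ) (w : ℝ × ℝ) : ℝ :=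
  (bump w.1 + bump w.2) + c * (bump w.1 * bump w.2)

theorem exists_norm_iteratedFDeriv_comp_le {φ : ℝ → ℝ} {N : ℕ} (hφ : ContDiff ℝ N φ)
    (hc : HasCompactSupport φ) (g : ℝ × ℝ →L[ℝ] ℝ) (j : ℕ) (hj : j ≤ N) :
    ∃ C, ∀ w, ‖iteratedFDeriv ℝ j (fun w => φ (g w)) w‖ ≤ C := by
  obtain ⟨C, hC⟩ := (hφ.continuous_iteratedFDeriv (m := j)
    (by exact_mod_cast hj)).bounded_above_of_compact_support (hc.iteratedFDeriv j)
  refine ⟨C * ∏ _i : Fin j, ‖g‖, fun w => ?_⟩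
  have h := g.iteratedFDeriv_comp_right hφ w (i := j) (by exact_mod_cast hj)
  rw [show (fun w => φ (g w)) = φ ∘ g from rfl, h]
  refine (ContinuousMultilinearMap.norm_compContinuousLinearMap_le _ _).trans ?_
  gcongr
  exact hC _

theorem contDiff_bumpKernel (c : ℝ) (N : ℕ) : ContDiff ℝ N (bumpKernel c) := by
  have h : ContDiff ℝ N bump := bump.contDiff
  unfold bumpKernel
  fun_prop

theorem exists_norm_iteratedFDeriv_bumpKernel_le (N : ℕ) :
    ∃ M, ∀ c ∈ Icc (0 : ℝ) 1, ∀ j ≤ N, ∀ w, ‖iteratedFDeriv ℝ j (bumpKernel c) w‖ ≤ M := by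
  have hb : ContDiff ℝ N bump := bump.contDiff
  have h1 : ContDiff ℝ N fun w : ℝ × ℝ => bump w.1 := by fun_prop
  have h2 : ContDiff ℝ N fun w : ℝ × ℝ => bump w.2 := by fun_prop
  have key : ∀ j ≤ N, ∃ C, ∀ c ∈ Icc (0 : ℝ) 1, ∀ w,
      ‖iteratedFDeriv ℝ j (bumpKernel c) w‖ ≤ C := by
    intro j hj
    obtain ⟨C₁, hC₁⟩ := exists_norm_iteratedFDeriv_comp_le hb bump.hasCompactSupport
      (ContinuousLinearMap.fst ℝ ℝ ℝ) j hj
    obtain ⟨C₂, hC₂⟩ := exists_norm_iteratedFDeriv_comp_le hb bump.hasCompactSupport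
      (ContinuousLinearMap.snd ℝ ℝ ℝ) j hj
    have hsupp : HasCompactSupport fun w : ℝ × ℝ => bump w.1 * bump w.2 := by
      refine HasCompactSupport.of_support_subset_isCompact
        ((isCompact_closedBall (0 : ℝ) 1).prod (isCompact_closedBall (0 : ℝ) 1)) fun w hw => ?_
      by_contra hcon
      refine hw ?_
      rw [mem_prod, not_and_or] at hcon
      simp only [Metric.mem_closedBall, dist_zero_right, Real.norm_eq_abs, not_le] at hcon
      rcases hcon with h | h
      · simp [bump_eq_zero h.le]
      · simp [bump_eq_zero h.le]
    obtain ⟨C₃, hC₃⟩ := ((h1.mul h2).continuous_iteratedFDeriv (m := j)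
      (by exact_mod_cast hj)).bounded_above_of_compact_support (hsupp.iteratedFDeriv j)
    refine ⟨C₁ + C₂ + C₃, fun c hc w => ?_⟩
    have h1' : ContDiffAt ℝ j (fun w : ℝ × ℝ => bump w.1) w :=
      (h1.of_le (by exact_mod_cast hj)).contDiffAt
    have h2' : ContDiffAt ℝ j (fun w : ℝ × ℝ => bump w.2) w :=
      (h2.of_le (by exact_mod_cast hj)).contDiffAt
    have heq : bumpKernel c = ((fun w : ℝ × ℝ => bump w.1) + fun w : ℝ × ℝ => bump w.2) +
      c • ((fun w : ℝ × ℝ => bump w.1) * fun w : ℝ × ℝ => bump w.2) := rfl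
    have h12 : ContDiffAt ℝ j ((fun w : ℝ × ℝ => bump w.1) + fun w : ℝ × ℝ => bump w.2) w :=
      h1'.add h2'
    have h3' : ContDiffAt ℝ j ((fun w : ℝ × ℝ => bump w.1) * fun w : ℝ × ℝ => bump w.2) w :=
      h1'.mul h2'
    have h4 : ContDiffAt ℝ j
        (c • ((fun w : ℝ × ℝ => bump w.1) * fun w : ℝ × ℝ => bump w.2)) w := h3'.const_smul c
    rw [heq, iteratedFDeriv_add_apply h12 h4, iteratedFDeriv_add_apply h1' h2',
      iteratedFDeriv_const_smul_apply h3']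
    refine (norm_add_le _ _).trans (add_le_add ((norm_add_le _ _).trans
      (add_le_add (hC₁ w) (hC₂ w))) ?_)
    rw [norm_smul, Real.norm_of_nonneg hc.1]
    exact (mul_le_of_le_one_left (norm_nonneg _) hc.2).trans (hC₃ w)
  choose! C hC using key
  refine ⟨∑ j ∈ Finset.range (N + 1), |C j|, fun c hc j hj w => (hC j hj c hc w).trans ?_⟩
  exact (le_abs_self _).trans (Finset.single_le_sum (f := fun j => |C j|)
    (fun _ _ => abs_nonneg _) (Finset.mem_range.2 (by omega)))

/-! ### Processes of rank one -/

/-- The process `x ↦ g x * ω` with a single standard normal variable `ω`. -/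
noncomputable def rankOne (g : I → ℝ) : RandomProcess where
  Ω := ℝ
  P := gaussianReal 0 1
  Z x ω := g x * ω

theorem kernel_rankOne (g : I → ℝ) (x y : I) : (rankOne g).kernel x y = g x * g y := by
  have h2 : ∫ ω, ω ^ 2 ∂gaussianReal 0 1 = 1 := by
    have h := variance_fun_id_gaussianReal (μ := 0) (v := 1)
    rw [variance_of_integral_eq_zero (by fun_prop) integral_id_gaussianReal] at h
    simpa using h
  calc (rankOne g).kernel x y = ∫ ω : ℝ, (g x * ω) * (g y * ω) ∂gaussianReal 0 1 := rfl
    _ = ∫ ω : ℝ, (g x * g y) * ω ^ 2 ∂gaussianReal 0 1 := by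
        congr 1; ext ω; ring
    _ = g x * g y := by rw [integral_const_mul, h2, mul_one]

theorem rankOne_mem_gaussianClass {g : I → ℝ} {γ L : ℝ}
    (h : extend (fun x y => g x * g y) ∈ holderClass γ L) : rankOne g ∈ gaussianClass γ L := by
  refine ⟨⟨fun J => ?_⟩, fun x => ?_, ?_⟩
  · have hid : HasGaussianLaw (id : ℝ → ℝ) (gaussianReal 0 1) := IsGaussian.hasGaussianLaw_id
    exact hid.map_fun (ContinuousLinearMap.pi fun x : J => g x • ContinuousLinearMap.id ℝ ℝ)
  · change ∫ ω : ℝ, g x * ω ∂gaussianReal 0 1 = 0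
    rw [integral_const_mul, integral_id_gaussianReal, mul_zero]
  · have : (rankOne g).kernel = fun x y => g x * g y := by
      ext x y; exact kernel_rankOne g x y
    rwa [this]

/-- A constant, perturbed by a bump of width `h` and relative height `h ^ γ` at `z`. -/
noncomputable def bumpProfile (A γ h z : ℝ) (x : I) : ℝ :=
  A * (1 + h ^ γ * bump (h⁻¹ * (x - z)))

/-- The constant can be chosen such that all profiles with a bump, and all smaller constants, lead
to processes in the class. -/
theorem exists_amplitude {γ L : ℝ} (hγ : 0 < γ) (hL : 0 < L) :
    ∃ A : ℝ, 0 < A ∧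
      (∀ h z : ℝ, 0 < h → h ≤ 1 → rankOne (bumpProfile A γ h z) ∈ gaussianClass γ L) ∧
      ∀ r : ℝ, 0 ≤ r → r ≤ 1 → rankOne (fun _ => A * r) ∈ gaussianClass γ L := by
  obtain ⟨M, hM⟩ := exists_norm_iteratedFDeriv_bumpKernel_le (holderOrder γ + 1)
  have hM0 : 0 ≤ M := (norm_nonneg _).trans (hM 0 (by simp) 0 (by omega) 0)
  have hA2 : √(L / (1 + 3 * M)) ^ 2 = L / (1 + 3 * M) := Real.sq_sqrt (by positivity)
  have hAL : L / (1 + 3 * M) ≤ L := div_le_self hL.le (by linarith)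
  refine ⟨√(L / (1 + 3 * M)), by positivity, fun h z h0 h1 => rankOne_mem_gaussianClass ?_,
    fun r hr0 hr1 => rankOne_mem_gaussianClass ?_⟩
  · set A := √(L / (1 + 3 * M)) with hA
    have hc : h ^ γ ∈ Icc (0 : ℝ) 1 := ⟨by positivity, Real.rpow_le_one h0.le h1 hγ.le⟩
    have hsm : ContDiff ℝ (holderOrder γ + 1 : ℕ) (A ^ 2 • bumpKernel (h ^ γ)) :=
      contDiff_const.mul (contDiff_bumpKernel _ _)
    refine mem_holderClass_of_rescale hγ (M := A ^ 2 * M) hsm (fun j hj w => ?_) h0 h1 (A ^ 2) (z, z) ?_ ?_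
    · rw [iteratedFDeriv_const_smul_apply (contDiff_bumpKernel _ _).contDiffAt, norm_smul,
        Real.norm_of_nonneg (sq_nonneg A)]
      gcongr
      exact hM _ hc j hj w
    · rw [abs_of_nonneg (sq_nonneg A), hA2]
      refine le_of_eq ?_
      field_simp
    · rintro ⟨w₁, w₂⟩ ⟨h1, h2, h3⟩
      simp only [extend, bumpProfile, bumpKernel, Pi.smul_apply, smul_eq_mul, Prod.smul_fst,
        Prod.smul_snd, Prod.fst_sub, Prod.snd_sub] at h1 h2 h3 ⊢
      rw [projIcc_of_mem zero_le_one ⟨h1, h2.trans h3⟩,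
        projIcc_of_mem zero_le_one ⟨h1.trans h2, h3⟩]
      ring
  · set A := √(L / (1 + 3 * M)) with hA
    refine mem_holderClass_of_rescale hγ (Ψ := fun _ => 0) (M := 0) contDiff_const
      (fun j _ w => ?_) one_pos le_rfl (A ^ 2 * r ^ 2) 0 ?_ fun w _ => ?_
    · simp
    · rw [abs_of_nonneg (by positivity), hA2, mul_zero, add_zero]
      exact (mul_le_of_le_one_right (by positivity) (pow_le_one₀ hr0 hr1)).trans hAL
    · simp only [extend]; ring

/-! ### Lower bounds for the risk of an estimator -/

/-- The law of the latent standard normal variables of `n` copies of a process of rank one. -/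
noncomputable def latent (n : ℕ) : Measure (Fin n → ℝ) :=
  Measure.pi fun _ : Fin n => gaussianReal 0 1

instance (n : ℕ) : IsProbabilityMeasure (latent n) := by unfold latent; infer_instance

/-- The observations without errors, when the process is `rankOne g`. -/
def signal {n p : ℕ} (μ : I → ℝ) (x : Fin p → I) (g : I → ℝ) (ω : Fin n → ℝ) :
    Fin n → Fin p → ℝ :=
  fun i j => μ (x j) + g (x j) * ω i

theorem measurable_signal {n p : ℕ} (μ : I → ℝ) (x : Fin p → I) (g : I → ℝ) :
    Measurable (signal (n := n) μ x g) := by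
  unfold signal; fun_prop

/-- The largest risk of an estimator over the class. -/
noncomputable def worstRisk (γ L : ℝ) {n p : ℕ} (μ : I → ℝ) (σ₀ : ℝ≥0) (x : Fin p → I)
    (G : Estimator n p) : ℝ≥0∞ :=
  ⨆ X ∈ gaussianClass γ L, risk μ σ₀ x G X

/-- The error of an estimate at a point `(z, z)` of the diagonal, for the process `rankOne g`. -/
noncomputable def diagError {n p : ℕ} (G : Estimator n p) (g : I → ℝ) (z : I)
    (Y : Fin n → Fin p → ℝ) : ℝ :=
  |G.toFun Y z z - g z * g z|

section Bounds

variable {γ L : ℝ} {n p : ℕ} {μ : I → ℝ} {σ₀ : ℝ≥0} {x : Fin p → I}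

theorem measurable_diagError (G : Estimator n p) (g : I → ℝ) (z : I) :
    Measurable (diagError G g z) :=
  ((G.measurable' z z).sub_const _).abs

theorem diagError_nonneg (G : Estimator n p) (g : I → ℝ) (z : I) (Y : Fin n → Fin p → ℝ) :
    0 ≤ diagError G g z Y := abs_nonneg _

theorem le_diagError_add (G : Estimator n p) (g₀ g₁ : I → ℝ) (z : I) (Y : Fin n → Fin p → ℝ) :
    |g₁ z * g₁ z - g₀ z * g₀ z| ≤ diagError G g₀ z Y + diagError G g₁ z Y := by
  unfold diagError
  rw [abs_sub_comm (G.toFun Y z z) (g₁ z * g₁ z), add_comm]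
  exact abs_sub_le _ _ _

theorem diagError_le_supDist (G : Estimator n p) (g : I → ℝ) (z : I) (Y : Fin n → Fin p → ℝ) :
    ENNReal.ofReal (diagError G g z Y) ≤ supDist (G.toFun Y) (rankOne g).kernel := by
  unfold diagError
  rw [← kernel_rankOne]
  exact le_iSup₂_of_le (f := fun x y =>
    ENNReal.ofReal |G.toFun Y x y - (rankOne g).kernel x y|) z z le_rfl

theorem measurable_lintegral_signal_add {U : (Fin n → Fin p → ℝ) → ℝ} (hU : Measurable U)
    (g : I → ℝ) (v : ℝ≥0) :
    Measurable fun ω : Fin n → ℝ =>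
      ∫⁻ ε, ENNReal.ofReal (U (signal μ x g ω + ε)) ∂noise n p v := by
  have h : Measurable fun q : (Fin n → ℝ) × (Fin n → Fin p → ℝ) =>
      ENNReal.ofReal (U (signal μ x g q.1 + q.2)) :=
    (hU.comp (((measurable_signal μ x g).comp measurable_fst).add
      measurable_snd)).ennreal_ofReal
  exact h.lintegral_prod_right'

/-- The risk is at least the expectation of any measurable function of the observations that is
dominated by the loss, which need not be measurable itself. -/
theorem lintegral_le_worstRisk {g : I → ℝ} (hg : rankOne g ∈ gaussianClass γ L)
    (G : Estimator n p) {U : (Fin n → Fin p → ℝ) → ℝ} (hU : Measurable U)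
    (hle : ∀ Y, ENNReal.ofReal (U Y) ≤ supDist (G.toFun Y) (rankOne g).kernel) :
    ∫⁻ ω, ∫⁻ ε, ENNReal.ofReal (U (signal μ x g ω + ε)) ∂noise n p (σ₀ ^ 2) ∂latent n ≤
      worstRisk γ L μ σ₀ x G := by
  have h : Measurable fun q : (Fin n → ℝ) × (Fin n → Fin p → ℝ) =>
      ENNReal.ofReal (U (signal μ x g q.1 + q.2)) :=
    (hU.comp (((measurable_signal μ x g).comp measurable_fst).add
      measurable_snd)).ennreal_ofReal
  refine le_trans ?_ (le_iSup₂ (f := fun X (_ : X ∈ gaussianClass γ L) => risk μ σ₀ x G X)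
    (rankOne g) hg)
  rw [lintegral_lintegral (f := fun ω ε => ENNReal.ofReal (U (signal μ x g ω + ε)))
    h.aemeasurable]
  exact lintegral_mono fun s => hle (signal μ x g s.1 + s.2)

/-- Two processes that coincide at the design points cannot be distinguished. -/
theorem worstRisk_ge_of_eq_on_design {g₀ g₁ : I → ℝ} (h₀ : rankOne g₀ ∈ gaussianClass γ L)
    (h₁ : rankOne g₁ ∈ gaussianClass γ L) (heq : ∀ j, g₁ (x j) = g₀ (x j)) (z : I)
    (G : Estimator n p) :
    ENNReal.ofReal (|g₁ z * g₁ z - g₀ z * g₀ z| / 2) ≤ worstRisk γ L μ σ₀ x G := by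
  set δ := |g₁ z * g₁ z - g₀ z * g₀ z| with hδ
  have hδ0 : 0 ≤ δ := abs_nonneg _
  have hsig : ∀ ω : Fin n → ℝ, signal μ x g₁ ω = signal μ x g₀ ω := fun ω => by
    ext i j; simp [signal, heq]
  have r₀ := lintegral_le_worstRisk (μ := μ) (σ₀ := σ₀) (x := x) h₀ G
    (measurable_diagError G g₀ z) (diagError_le_supDist G g₀ z)
  have r₁ := lintegral_le_worstRisk (μ := μ) (σ₀ := σ₀) (x := x) h₁ G
    (measurable_diagError G g₁ z) (diagError_le_supDist G g₁ z)
  simp_rw [hsig] at r₁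
  have hmeas : ∀ ω : Fin n → ℝ, Measurable fun ε =>
      ENNReal.ofReal (diagError G g₀ z (signal μ x g₀ ω + ε)) := fun ω =>
    ((measurable_diagError G g₀ z).comp (measurable_const_add _)).ennreal_ofReal
  have hsum : ENNReal.ofReal δ ≤ worstRisk γ L μ σ₀ x G + worstRisk γ L μ σ₀ x G := by
    refine le_trans ?_ (add_le_add r₀ r₁)
    rw [← lintegral_add_left (measurable_lintegral_signal_add (measurable_diagError G g₀ z) _ _)]
    calc ENNReal.ofReal δ = ∫⁻ _ : Fin n → ℝ, ENNReal.ofReal δ ∂latent n := by simp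
      _ ≤ _ := lintegral_mono fun ω => ?_
    rw [← lintegral_add_left (hmeas ω)]
    calc ENNReal.ofReal δ = ∫⁻ _, ENNReal.ofReal δ ∂noise n p (σ₀ ^ 2) := by simp
      _ ≤ _ := lintegral_mono fun ε => ?_
    rw [← ENNReal.ofReal_add (diagError_nonneg _ _ _ _) (diagError_nonneg _ _ _ _)]
    exact ENNReal.ofReal_le_ofReal (le_diagError_add G g₀ g₁ z _)
  have h2 : ENNReal.ofReal δ = 2 * ENNReal.ofReal (δ / 2) := by
    rw [two_mul, ← ENNReal.ofReal_add (by positivity) (by positivity), add_halves]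
  rw [h2, ← two_mul] at hsum
  exact (ENNReal.mul_le_mul_iff_right two_ne_zero ENNReal.ofNat_ne_top).1 hsum

theorem latent_map_mul {u : ℝ} (hu : 0 ≤ u) :
    (latent n).map (fun ω i => (√(1 + u))⁻¹ * ω i) =
      (latent n).withDensity fun ω => ENNReal.ofReal (∏ i, dilationRatio u (ω i)) := by
  have h := pi_map_eq_withDensity (fun _ : Fin n => gaussianReal 0 1)
    (T := fun _ x => (√(1 + u))⁻¹ * x) (f := fun _ x => ENNReal.ofReal (dilationRatio u x))
    (fun i => by fun_prop) (fun i => (measurable_dilationRatio u).ennreal_ofReal)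
    (fun i => gaussianReal_map_mul_eq_withDensity hu)
  simp_rw [ENNReal.ofReal_prod_of_nonneg fun i _ => dilationRatio_nonneg u _]
  exact h

theorem lintegral_prod_dilationRatio {u : ℝ} (hu : 0 ≤ u) :
    ∫⁻ ω, ENNReal.ofReal (∏ i, dilationRatio u (ω i)) ∂latent n = 1 := by
  simp_rw [ENNReal.ofReal_prod_of_nonneg fun i _ => dilationRatio_nonneg u _]
  rw [latent, lintegral_pi_prod (f := fun _ x => ENNReal.ofReal (dilationRatio u x)) _
    fun i => (measurable_dilationRatio u).ennreal_ofReal]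
  simp [lintegral_dilationRatio hu]

theorem lintegral_prod_dilationRatio_sq_le {u : ℝ} (hu : 0 ≤ u) :
    ∫⁻ ω, ENNReal.ofReal ((∏ i, dilationRatio u (ω i)) ^ 2) ∂latent n ≤
      ENNReal.ofReal (Real.exp (n * u ^ 2 / 2)) := by
  simp_rw [← Finset.prod_pow, ENNReal.ofReal_prod_of_nonneg fun i _ => sq_nonneg
    (dilationRatio u _)]
  rw [latent, lintegral_pi_prod (f := fun _ x => ENNReal.ofReal (dilationRatio u x ^ 2)) _
    fun i => ((measurable_dilationRatio u).pow_const 2).ennreal_ofReal]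
  refine (Finset.prod_le_prod' fun i _ => lintegral_dilationRatio_sq_le hu).trans ?_
  rw [Finset.prod_const, Finset.card_univ, Fintype.card_fin, ← ENNReal.ofReal_pow
    (Real.exp_pos _).le, ← Real.exp_nat_mul, mul_div_assoc]

/-- The variance of the latent variables can only be estimated up to an error of the order
`n ^ (-1/2)`. -/
theorem worstRisk_ge_of_dilation {A : ℝ}
    (hclass : ∀ r : ℝ, 0 ≤ r → r ≤ 1 → rankOne (fun _ => A * r) ∈ gaussianClass γ L)
    {u : ℝ} (hu : 0 ≤ u) (hnu : n * u ^ 2 ≤ 1) (G : Estimator n p) :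
    ENNReal.ofReal (A ^ 2 * (u / (1 + u)) / 4) ≤ worstRisk γ L μ σ₀ x G := by
  have h1u : 0 < 1 + u := by linarith
  set r := (√(1 + u))⁻¹ with hr
  have hr2 : r ^ 2 = (1 + u)⁻¹ := by rw [hr, inv_pow, Real.sq_sqrt h1u.le]
  have hr1 : r ≤ 1 := inv_le_one_of_one_le₀ (Real.one_le_sqrt.2 (by linarith))
  have hr0 : 0 ≤ r := by positivity
  set z : I := 0
  set g₀ : I → ℝ := fun _ => A * 1 with hg₀
  set g₁ : I → ℝ := fun _ => A * r with hg₁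
  set δ := A ^ 2 * (u / (1 + u)) with hδ
  have hδ0 : 0 ≤ δ := by positivity
  have hδle : ∀ Y, δ ≤ diagError G g₀ z Y + diagError G g₁ z Y := fun Y => by
    refine le_trans (le_of_eq ?_) (le_diagError_add G g₀ g₁ z Y)
    have : g₁ z * g₁ z - g₀ z * g₀ z = -δ := by
      simp only [hg₀, hg₁]
      rw [mul_mul_mul_comm, ← sq r, hr2, hδ]
      field_simp
      ring
    rw [this, abs_neg, abs_of_nonneg hδ0]
  have r₀ := lintegral_le_worstRisk (μ := μ) (σ₀ := σ₀) (x := x) (hclass 1 zero_le_one le_rfl) G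
    (measurable_diagError G g₀ z) (diagError_le_supDist G g₀ z)
  have r₁ := lintegral_le_worstRisk (μ := μ) (σ₀ := σ₀) (x := x) (hclass r hr0 hr1) G
    (measurable_diagError G g₁ z) (diagError_le_supDist G g₁ z)
  have hmeas : ∀ {U : (Fin n → Fin p → ℝ) → ℝ}, Measurable U → ∀ g,
      Measurable fun q : (Fin n → ℝ) × (Fin n → Fin p → ℝ) =>
        ENNReal.ofReal (U (signal μ x g q.1 + q.2)) := fun hU g =>
    (hU.comp (((measurable_signal μ x g).comp measurable_fst).add
      measurable_snd)).ennreal_ofReal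
  rw [lintegral_lintegral_swap (hmeas (measurable_diagError G g₀ z) g₀).aemeasurable] at r₀
  rw [lintegral_lintegral_swap (hmeas (measurable_diagError G g₁ z) g₁).aemeasurable] at r₁
  have hdens : Measurable fun ω : Fin n → ℝ => ∏ i, dilationRatio u (ω i) :=
    Finset.measurable_prod _ fun i _ => (measurable_dilationRatio u).comp (measurable_pi_apply i)
  have hexp : Real.exp (n * u ^ 2 / 2) ≤ 2 := by
    rw [← Real.le_log_iff_exp_le two_pos]
    linarith [Real.log_two_gt_d9]
  -- For fixed errors, the observations are a function of the latent variables, which are dilated.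
  have hpt : ∀ ε : Fin n → Fin p → ℝ, ENNReal.ofReal (δ / 2) ≤
      ∫⁻ ω, ENNReal.ofReal (diagError G g₀ z (signal μ x g₀ ω + ε)) ∂latent n +
        ∫⁻ ω, ENNReal.ofReal (diagError G g₁ z (signal μ x g₁ ω + ε)) ∂latent n := by
    intro ε
    have hm : ∀ g, Measurable fun ω : Fin n → ℝ => diagError G g z (signal μ x g₀ ω + ε) :=
      fun g => (measurable_diagError G g z).comp ((measurable_signal μ x g₀).add_const ε)
    have key := average_risk_ge (ι := Unit) (latent n)
      (l := fun _ ω => ∏ i, dilationRatio u (ω i)) (fun _ => hdens)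
      (fun _ ω => Finset.prod_nonneg fun i _ => dilationRatio_nonneg u _)
      (fun _ => lintegral_prod_dilationRatio hu)
      (U₀ := fun ω => diagError G g₀ z (signal μ x g₀ ω + ε))
      (U := fun _ ω => diagError G g₁ z (signal μ x g₀ ω + ε)) (hm g₀) (fun _ => hm g₁)
      (fun ω => diagError_nonneg _ _ _ _) (fun _ ω => diagError_nonneg _ _ _ _) hδ0
      (fun _ ω => hδle _) (by
        simp only [Finset.univ_unique, Finset.sum_singleton, Fintype.card_unit]
        refine (lintegral_prod_dilationRatio_sq_le hu).trans (ENNReal.ofReal_le_ofReal ?_)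
        simpa using hexp)
    have hT := lintegral_comp_of_map_eq_withDensity (by fun_prop) hdens (latent_map_mul hu) (hm g₁)
      (fun ω => diagError_nonneg _ _ _ _)
    have hsig : ∀ ω : Fin n → ℝ, signal μ x g₁ ω =
        signal μ x g₀ fun i => (√(1 + u))⁻¹ * ω i := fun ω => by
      ext i j; simp only [signal, hg₀, hg₁, hr]; ring
    simp only [Finset.univ_unique, Finset.sum_singleton, Fintype.card_unit, Nat.cast_one,
      one_mul] at key
    rw [← hT] at key
    simp_rw [hsig]
    exact key
  have hsum : ENNReal.ofReal (δ / 2) ≤ worstRisk γ L μ σ₀ x G + worstRisk γ L μ σ₀ x G := by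
    refine le_trans ?_ (add_le_add r₀ r₁)
    rw [← lintegral_add_left
      (hmeas (measurable_diagError G g₀ z) g₀).lintegral_prod_left']
    calc ENNReal.ofReal (δ / 2) = ∫⁻ _, ENNReal.ofReal (δ / 2) ∂noise n p (σ₀ ^ 2) := by simp
      _ ≤ _ := lintegral_mono hpt
  have h2 : ENNReal.ofReal (δ / 2) = 2 * ENNReal.ofReal (δ / 4) := by
    rw [two_mul, ← ENNReal.ofReal_add (by positivity) (by positivity)]
    congr 1; ring
  rw [h2, ← two_mul] at hsum
  exact (ENNReal.mul_le_mul_iff_right two_ne_zero ENNReal.ofNat_ne_top).1 hsum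

theorem lintegral_sum_sq_latent :
    ∫⁻ ω, ENNReal.ofReal (∑ i, ω i ^ 2) ∂latent n = n := by
  have h2 : ∫⁻ t, ENNReal.ofReal (t ^ 2) ∂gaussianReal 0 1 = 1 := by
    have h := variance_fun_id_gaussianReal (μ := 0) (v := 1)
    rw [variance_of_integral_eq_zero (by fun_prop) integral_id_gaussianReal] at h
    have hi : Integrable (fun t : ℝ => t ^ 2) (gaussianReal 0 1) :=
      (memLp_id_gaussianReal 2).integrable_sq
    rw [← ofReal_integral_eq_lintegral_ofReal hi
      (ae_of_all _ fun t => sq_nonneg t)]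
    simpa using congrArg ENNReal.ofReal h
  simp_rw [ENNReal.ofReal_sum_of_nonneg fun i _ => sq_nonneg _]
  rw [lintegral_finsetSum _ fun i _ => by fun_prop]
  have h3 : ∀ i : Fin n, ∫⁻ ω, ENNReal.ofReal (ω i ^ 2) ∂latent n = 1 := fun i => by
    rw [← h2]
    exact (measurePreserving_eval (fun _ : Fin n => gaussianReal 0 1) i).lintegral_comp
      (f := fun t => ENNReal.ofReal (t ^ 2)) (by fun_prop)
  simp [h3]

/-- Orthogonal shifts of the noise: the average of their likelihood ratios has second moment at
most `2` as soon as the energy of each of them is at most `log m`, where `m` is their number. The mixed second moments are `1`. -/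
theorem lintegral_sum_shiftRatio_sq_le {m : ℕ} {v : ℝ≥0} (hv : v ≠ 0)
    (θ : Fin m → Fin n → Fin p → ℝ)
    (horth : ∀ k l, k ≠ l → ∑ i, ∑ j, θ k i j * θ l i j = 0)
    (henergy : ∀ k, Real.exp ((∑ i, ∑ j, θ k i j * θ k i j) / v) ≤ m) :
    ∫⁻ ε, ENNReal.ofReal ((∑ k, shiftRatio v (θ k) ε) ^ 2) ∂noise n p v ≤
      ENNReal.ofReal (2 * (m : ℝ) ^ 2) := by
  have hpos : ∀ k l ε, 0 ≤ shiftRatio v (θ k) ε * shiftRatio v (θ l) ε := fun k l ε =>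
    mul_nonneg (shiftRatio_nonneg v _ _) (shiftRatio_nonneg v _ _)
  have hmm : ∀ k l, Measurable fun ε =>
      ENNReal.ofReal (shiftRatio v (θ k) ε * shiftRatio v (θ l) ε) := fun k l =>
    ((measurable_shiftRatio v _).mul (measurable_shiftRatio v _)).ennreal_ofReal
  have hexpand : ∀ ε, ENNReal.ofReal ((∑ k, shiftRatio v (θ k) ε) ^ 2) =
      ∑ k, ∑ l, ENNReal.ofReal (shiftRatio v (θ k) ε * shiftRatio v (θ l) ε) := fun ε => by
    rw [sq, Finset.sum_mul_sum,
      ENNReal.ofReal_sum_of_nonneg fun k _ => Finset.sum_nonneg fun l _ => hpos k l ε]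
    exact Finset.sum_congr rfl fun k _ => ENNReal.ofReal_sum_of_nonneg fun l _ => hpos k l ε
  simp_rw [hexpand]
  rw [lintegral_finsetSum Finset.univ
    (f := fun k ε => ∑ l, ENNReal.ofReal (shiftRatio v (θ k) ε * shiftRatio v (θ l) ε))
    fun k _ => Finset.measurable_sum _ fun l _ => hmm k l]
  have hterm : ∀ k l, ∫⁻ ε, ENNReal.ofReal (shiftRatio v (θ k) ε * shiftRatio v (θ l) ε)
      ∂noise n p v ≤ ENNReal.ofReal (1 + if k = l then (m : ℝ) else 0) := by
    intro k l
    rw [lintegral_shiftRatio_mul hv]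
    refine ENNReal.ofReal_le_ofReal ?_
    split_ifs with h
    · subst h
      linarith [henergy k]
    · rw [horth k l h]; simp
  calc _ ≤ ∑ k : Fin m, ∑ l : Fin m, ENNReal.ofReal (1 + if k = l then (m : ℝ) else 0) := by
        refine Finset.sum_le_sum fun k _ => ?_
        rw [lintegral_finsetSum _ fun l _ => hmm k l]
        exact Finset.sum_le_sum fun l _ => hterm k l
    _ = ENNReal.ofReal (∑ k : Fin m, ∑ l : Fin m, (1 + if k = l then (m : ℝ) else 0)) := by
        have h0 : ∀ k l : Fin m, 0 ≤ 1 + if k = l then (m : ℝ) else 0 := fun k l => by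
          split_ifs <;> positivity
        rw [ENNReal.ofReal_sum_of_nonneg fun k _ => Finset.sum_nonneg fun l _ => h0 k l]
        simp_rw [ENNReal.ofReal_sum_of_nonneg fun l _ => h0 _ l]
    _ ≤ _ := by
        refine ENNReal.ofReal_le_ofReal (le_of_eq ?_)
        simp [Finset.sum_add_distrib]
        ring

/-- The testing bound `average_risk_ge` for orthogonal shifts of the noise. -/
theorem average_risk_ge_of_shifts {m : ℕ} (hm : 0 < m) {v : ℝ≥0} (hv : v ≠ 0)
    (θ : Fin m → Fin n → Fin p → ℝ)
    (horth : ∀ k l, k ≠ l → ∑ i, ∑ j, θ k i j * θ l i j = 0)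
    (henergy : ∀ k, Real.exp ((∑ i, ∑ j, θ k i j * θ k i j) / v) ≤ m)
    {U₀ : (Fin n → Fin p → ℝ) → ℝ} {U : Fin m → (Fin n → Fin p → ℝ) → ℝ}
    (hU₀m : Measurable U₀) (hUm : ∀ k, Measurable (U k)) (hU₀ : ∀ Y, 0 ≤ U₀ Y)
    (hU : ∀ k Y, 0 ≤ U k Y) {δ : ℝ} (hδ : 0 ≤ δ) (hsep : ∀ k Y, δ ≤ U₀ Y + U k Y) :
    ENNReal.ofReal (m * (δ / 2)) ≤ m * ∫⁻ ε, ENNReal.ofReal (U₀ ε) ∂noise n p v +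
      ∑ k, ∫⁻ ε, ENNReal.ofReal (U k (ε + θ k)) ∂noise n p v := by
  have hne : Nonempty (Fin m) := ⟨⟨0, hm⟩⟩
  have hdens : ∀ k, Measurable (shiftRatio v (θ k)) := fun k => measurable_shiftRatio v (θ k)
  have key := average_risk_ge (noise n p v) (l := fun k => shiftRatio v (θ k)) hdens
    (fun k ε => shiftRatio_nonneg _ _ _) (fun k => lintegral_shiftRatio hv (θ k)) hU₀m hUm hU₀ hU hδ hsep (by
      rw [Fintype.card_fin]
      exact lintegral_sum_shiftRatio_sq_le hv θ horth henergy)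
  rw [Fintype.card_fin] at key
  refine key.trans (le_of_eq ?_)
  congr 1
  exact Finset.sum_congr rfl fun k _ => (lintegral_comp_of_map_eq_withDensity
    (measurable_add_const (θ k)) (hdens k) (noise_map_add hv (θ k)) (hUm k) (hU k)).symm

/-- Lower bound from many perturbations of a profile `g₀` that do not interact at the design
points. Conditionally on the latent variables `ω`, the perturbations are shifts of the noise with
energy at most `S * ∑ i, ω i ^ 2`, and this sum is mostly below `2 * n`, twice its mean. -/
theorem worstRisk_ge_of_shifts (hσ₀ : 0 < σ₀) (hn : 0 < n) {m : ℕ} (hm : 0 < m) {g₀ : I → ℝ}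
    {g : Fin m → I → ℝ} (h₀ : rankOne g₀ ∈ gaussianClass γ L)
    (h : ∀ k, rankOne (g k) ∈ gaussianClass γ L) (z : Fin m → I) {δ S : ℝ} (hδ : 0 ≤ δ)
    (hsep : ∀ k, δ ≤ |g k (z k) * g k (z k) - g₀ (z k) * g₀ (z k)|)
    (horth : ∀ k l, k ≠ l → ∀ j, (g k (x j) - g₀ (x j)) * (g l (x j) - g₀ (x j)) = 0)
    (hS : ∀ k, ∑ j, (g k (x j) - g₀ (x j)) ^ 2 ≤ S)
    (hSm : Real.exp (2 * n * S / (σ₀ : ℝ) ^ 2) ≤ m) (G : Estimator n p) :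
    ENNReal.ofReal (δ / 8) ≤ worstRisk γ L μ σ₀ x G := by
  have hv : σ₀ ^ 2 ≠ 0 := by positivity
  have hS0 : 0 ≤ S := (Finset.sum_nonneg fun j _ => sq_nonneg _).trans (hS ⟨0, hm⟩)
  have hne : Nonempty (Fin m) := ⟨⟨0, hm⟩⟩
  set W := worstRisk γ L μ σ₀ x G with hW
  set U₀ : (Fin n → Fin p → ℝ) → ℝ := fun Y =>
    Finset.univ.sup' Finset.univ_nonempty fun k => diagError G g₀ (z k) Y with hU₀
  set U : Fin m → (Fin n → Fin p → ℝ) → ℝ := fun k => diagError G (g k) (z k) with hU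
  have hU₀m : Measurable U₀ := by
    have := Finset.measurable_sup' (s := (Finset.univ : Finset (Fin m))) Finset.univ_nonempty
      (f := fun k Y => diagError G g₀ (z k) Y) fun k _ => measurable_diagError G g₀ (z k)
    convert this using 1
    ext Y
    rw [Finset.sup'_apply]
  have hUm : ∀ k, Measurable (U k) := fun k => measurable_diagError G (g k) (z k)
  have hU₀le : ∀ k Y, diagError G g₀ (z k) Y ≤ U₀ Y := fun k Y =>
    Finset.le_sup' (fun k => diagError G g₀ (z k) Y) (Finset.mem_univ k)
  have hU₀0 : ∀ Y, 0 ≤ U₀ Y := fun Y => (diagError_nonneg _ _ _ _).trans (hU₀le ⟨0, hm⟩ Y)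
  have hU0 : ∀ k Y, 0 ≤ U k Y := fun k Y => diagError_nonneg _ _ _ _
  have r₀ := lintegral_le_worstRisk (μ := μ) (σ₀ := σ₀) (x := x) h₀ G hU₀m fun Y => by
    obtain ⟨k, -, hk⟩ := Finset.exists_mem_eq_sup' (Finset.univ_nonempty (α := Fin m))
      fun k => diagError G g₀ (z k) Y
    simp only [hU₀]
    rw [hk]
    exact diagError_le_supDist G g₀ (z k) Y
  have r := fun k => lintegral_le_worstRisk (μ := μ) (σ₀ := σ₀) (x := x) (h k) G (hUm k)
    (diagError_le_supDist G (g k) (z k))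
  have hsum : ∀ ω : Fin n → ℝ, 0 ≤ ∑ i, ω i ^ 2 := fun ω =>
    Finset.sum_nonneg fun i _ => sq_nonneg _
  -- Conditional bound. For `∑ i, ω i ^ 2 ≥ 2 * n`, the last term on the right suffices; its mean is
  -- only half of the left-hand side.
  have hpt : ∀ ω : Fin n → ℝ, ENNReal.ofReal (m * (δ / 2)) ≤
      (m * ∫⁻ ε, ENNReal.ofReal (U₀ (signal μ x g₀ ω + ε)) ∂noise n p (σ₀ ^ 2) +
        ∑ k, ∫⁻ ε, ENNReal.ofReal (U k (signal μ x (g k) ω + ε)) ∂noise n p (σ₀ ^ 2)) +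
      ENNReal.ofReal (m * (δ / 2) / (2 * n)) * ENNReal.ofReal (∑ i, ω i ^ 2) := by
    intro ω
    rcases le_total (2 * n : ℝ) (∑ i, ω i ^ 2) with hω | hω
    · refine le_add_left ?_
      rw [← ENNReal.ofReal_mul (by positivity)]
      refine ENNReal.ofReal_le_ofReal ?_
      rw [div_mul_eq_mul_div, le_div_iff₀ (by positivity)]
      gcongr
    · refine le_add_right ?_
      set θ : Fin m → Fin n → Fin p → ℝ := fun k i j => (g k (x j) - g₀ (x j)) * ω i with hθ
      have hsig : ∀ k ε, signal μ x (g k) ω + ε = signal μ x g₀ ω + (ε + θ k) := fun k ε => by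
        ext i j; simp only [signal, hθ, Pi.add_apply]; ring
      have hmeas : ∀ {V : (Fin n → Fin p → ℝ) → ℝ}, Measurable V →
          Measurable fun ε => V (signal μ x g₀ ω + ε) := fun hV =>
        hV.comp (measurable_const_add _)
      have horth' : ∀ k l, k ≠ l → ∑ i, ∑ j, θ k i j * θ l i j = 0 := fun k l hkl => by
        refine Finset.sum_eq_zero fun i _ => Finset.sum_eq_zero fun j _ => ?_
        simp only [hθ]
        rw [mul_mul_mul_comm, horth k l hkl j, zero_mul]
      have henergy : ∀ k, Real.exp ((∑ i, ∑ j, θ k i j * θ k i j) / (σ₀ ^ 2 : ℝ≥0)) ≤ m :=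
        fun k => by
        refine le_trans (Real.exp_le_exp.2 ?_) hSm
        rw [NNReal.coe_pow]
        gcongr
        calc ∑ i, ∑ j, θ k i j * θ k i j
            = (∑ i, ω i ^ 2) * ∑ j, (g k (x j) - g₀ (x j)) ^ 2 := by
              rw [Finset.sum_mul_sum]
              refine Finset.sum_congr rfl fun i _ => Finset.sum_congr rfl fun j _ => ?_
              simp only [hθ]; ring
          _ ≤ 2 * n * S := mul_le_mul hω (hS k)
              (Finset.sum_nonneg fun j _ => sq_nonneg _) (by positivity)
      simp_rw [hsig]
      exact average_risk_ge_of_shifts hm hv θ horth' henergy (hmeas hU₀m)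
        (fun k => hmeas (hUm k)) (fun ε => hU₀0 _) (fun k ε => hU0 k _) hδ fun k ε =>
        (hsep k).trans ((le_diagError_add G g₀ (g k) (z k) _).trans
          (add_le_add_left (hU₀le k _) _))
  have hX : Measurable fun ω : Fin n → ℝ =>
      ENNReal.ofReal (m * (δ / 2) / (2 * n)) * ENNReal.ofReal (∑ i, ω i ^ 2) := by fun_prop
  have hI₀ := measurable_lintegral_signal_add (μ := μ) (x := x) hU₀m g₀ (σ₀ ^ 2)
  have hI := fun k => measurable_lintegral_signal_add (μ := μ) (x := x) (hUm k) (g k) (σ₀ ^ 2)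
  have htot : ENNReal.ofReal (m * (δ / 2)) ≤
      (m * W + m * W) + ENNReal.ofReal (m * (δ / 4)) := by
    calc ENNReal.ofReal (m * (δ / 2))
        = ∫⁻ _ : Fin n → ℝ, ENNReal.ofReal (m * (δ / 2)) ∂latent n := by simp
      _ ≤ _ := lintegral_mono hpt
      _ = _ := by
          rw [lintegral_add_right _ hX, lintegral_add_left (hI₀.const_mul _),
            lintegral_const_mul _ hI₀, lintegral_finsetSum _ fun k _ => hI k,
            lintegral_const_mul _ (by fun_prop), lintegral_sum_sq_latent]
      _ ≤ (m * W + ∑ _k : Fin m, W) + ENNReal.ofReal (m * (δ / 4)) := by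
          refine add_le_add (add_le_add (mul_le_mul_right r₀ _)
            (Finset.sum_le_sum fun k _ => r k)) (le_of_eq ?_)
          rw [← ENNReal.ofReal_natCast, ← ENNReal.ofReal_mul (by positivity)]
          congr 1
          field_simp
          ring
      _ = _ := by simp
  have hsplit : ENNReal.ofReal (m * (δ / 2)) =
      (m * 2) * ENNReal.ofReal (δ / 8) + ENNReal.ofReal (m * (δ / 4)) := by
    rw [← ENNReal.ofReal_natCast, ← ENNReal.ofReal_ofNat, ← ENNReal.ofReal_mul (by positivity),
      ← ENNReal.ofReal_mul (by positivity), ← ENNReal.ofReal_add (by positivity) (by positivity)]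
    congr 1
    ring
  rw [hsplit] at htot
  have := (ENNReal.add_le_add_iff_right ENNReal.ofReal_ne_top).1 htot
  rw [← two_mul, ← mul_assoc, mul_comm (2 : ℝ≥0∞)] at this
  refine (ENNReal.mul_le_mul_iff_right ?_ ?_).1 this
  · exact mul_ne_zero (by exact_mod_cast hm.ne') two_ne_zero
  · exact ENNReal.mul_ne_top (ENNReal.natCast_ne_top m) ENNReal.ofNat_ne_top

end Bounds

/-! ### Spacing of the design points -/

/-- Points of a design are at least of the order `1 / p` apart from each other and from `0`,
because the density is bounded above. -/
theorem IsDesignDensity.exists_spacing {f : ℝ → ℝ} (hf : IsDesignDensity f) :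
    ∃ B : ℝ, 1 ≤ B ∧ ∀ (p : ℕ) (x : Fin p → I), IsDesign f x →
      (∀ j, 1 / 2 ≤ p * B * (x j : ℝ)) ∧
      ∀ j j' : Fin p, |(j : ℝ) - (j' : ℝ)| ≤ p * B * |(x j : ℝ) - (x j' : ℝ)| := by
  obtain ⟨K, hK⟩ := hf.lipschitz
  obtain ⟨fmin, fmax, h0, hb⟩ := hf.bounds
  refine ⟨max fmax 1, le_max_right _ _, fun p x hx => ?_⟩
  set B := max fmax 1 with hB
  have hint : ∀ a b : I, IntervalIntegrable f volume (a : ℝ) (b : ℝ) := fun a b => by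
    refine ContinuousOn.intervalIntegrable (hK.continuousOn.mono ?_)
    exact uIcc_subset_Icc a.2 b.2
  have hle : ∀ a b : I, |∫ t in (a : ℝ)..(b : ℝ), f t| ≤ B * |(b : ℝ) - a| := fun a b => by
    rw [← Real.norm_eq_abs]
    refine intervalIntegral.norm_integral_le_of_norm_le_const fun t ht => ?_
    have ht' : t ∈ Icc (0 : ℝ) 1 := uIcc_subset_Icc a.2 b.2 (uIoc_subset_uIcc ht)
    rw [Real.norm_of_nonneg (h0.le.trans (hb t ht').1)]
    exact (hb t ht').2.trans (le_max_left _ _)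
  have hp : ∀ _ : Fin p, (0 : ℝ) < p := fun j => by exact_mod_cast j.pos
  refine ⟨fun j => ?_, fun j j' => ?_⟩
  · have h := hle 0 (x j)
    rw [Icc.coe_zero, hx j, sub_zero, abs_of_nonneg (x j).2.1,
      abs_of_nonneg (by positivity), div_le_iff₀ (hp j)] at h
    have : (0 : ℝ) ≤ (j : ℝ) := by positivity
    linarith
  · have h := hle (x j') (x j)
    rw [← intervalIntegral.integral_interval_sub_left (hint 0 (x j)) (hint 0 (x j')),
      Icc.coe_zero, hx j, hx j', ← sub_div, add_sub_add_right_eq_sub, abs_div,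
      abs_of_pos (hp j), div_le_iff₀ (hp j)] at h
    linarith

theorem card_le_of_abs_sub_le {p : ℕ} (s : Finset (Fin p)) {D : ℝ} (hD : 0 ≤ D)
    (h : ∀ j ∈ s, ∀ j' ∈ s, |(j : ℝ) - (j' : ℝ)| ≤ D) : (s.card : ℝ) ≤ D + 1 := by
  rcases s.eq_empty_or_nonempty with rfl | hs
  · simp; linarith
  · set a := s.min' hs
    set b := s.max' hs
    have hab : (a : ℕ) ≤ b := s.min'_le_max' hs
    have hsub : s ⊆ Finset.Icc a b := fun j hj =>
      Finset.mem_Icc.2 ⟨s.min'_le j hj, s.le_max' j hj⟩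
    have hc := Finset.card_le_card hsub
    rw [Fin.card_Icc] at hc
    have hc' : (s.card : ℝ) ≤ (b : ℝ) + 1 - (a : ℝ) := by
      rw [← Nat.cast_add_one, ← Nat.cast_sub (by omega)]
      exact_mod_cast hc
    have := (le_abs_self _).trans (h b (s.max'_mem hs) a (s.min'_mem hs))
    linarith

/-! ### The three lower bounds -/

theorem bumpProfile_center (A γ h : ℝ) (z : I) :
    bumpProfile A γ h z z = A * (1 + h ^ γ) := by
  rw [bumpProfile, sub_self, mul_zero, bump_zero, mul_one]

theorem bumpProfile_sub (A γ h z : ℝ) (x : I) :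
    bumpProfile A γ h z x - A * 1 = A * h ^ γ * bump (h⁻¹ * (x - z)) := by
  unfold bumpProfile; ring

theorem bump_rescale_eq_zero {h t z : ℝ} (h0 : 0 < h) (ht : h ≤ |t - z|) :
    bump (h⁻¹ * (t - z)) = 0 := by
  refine bump_eq_zero ?_
  rw [abs_mul, abs_of_pos (inv_pos.2 h0), inv_mul_eq_div]
  exact (one_le_div h0).2 ht

theorem le_abs_bumpProfile_sq_sub {A h γ : ℝ} (h0 : 0 < h) (z : I) :
    2 * (A ^ 2 * h ^ γ) ≤
      |bumpProfile A γ h z z * bumpProfile A γ h z z - A * 1 * (A * 1)| := by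
  refine le_trans ?_ (le_abs_self _)
  rw [bumpProfile_center]
  have : 0 ≤ A ^ 2 * (h ^ γ) ^ 2 := by positivity
  nlinarith

section Bounds

variable {γ L : ℝ} {n p : ℕ} {μ : I → ℝ} {σ₀ : ℝ≥0} {x : Fin p → I} {A B : ℝ}

/-- The error of the order `n ^ (-1/2)`, from estimating the variance of `n` latent variables. -/
theorem worstRisk_ge_sampling (hn : 0 < n)
    (hclass : ∀ r : ℝ, 0 ≤ r → r ≤ 1 → rankOne (fun _ => A * r) ∈ gaussianClass γ L)
    (G : Estimator n p) :
    ENNReal.ofReal (A ^ 2 / 8 * (n : ℝ) ^ (-(1 / 2) : ℝ)) ≤ worstRisk γ L μ σ₀ x G := by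
  have hn' : (0 : ℝ) < n := by exact_mod_cast hn
  set u : ℝ := (n : ℝ) ^ (-(1 / 2) : ℝ) with hu
  have hu0 : 0 < u := by positivity
  have hu1 : u ≤ 1 := Real.rpow_le_one_of_one_le_of_nonpos (by exact_mod_cast hn) (by norm_num)
  have hu2 : n * u ^ 2 = 1 := by
    rw [hu, ← Real.rpow_natCast, ← Real.rpow_mul hn'.le]
    norm_num
    rw [Real.rpow_neg_one, mul_inv_cancel₀ hn'.ne']
  refine le_trans (ENNReal.ofReal_le_ofReal ?_) (worstRisk_ge_of_dilation hclass hu0.le hu2.le G)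
  have : u / 2 ≤ u / (1 + u) := by gcongr; linarith
  nlinarith [mul_le_mul_of_nonneg_left this (sq_nonneg A)]

/-- The error of the order `p ^ (-γ)`, from a bump between the design points. -/
theorem worstRisk_ge_discretization (hp : 0 < p) (hB : 1 ≤ B)
    (hx : ∀ j, 1 / 2 ≤ p * B * (x j : ℝ)) (h₀ : rankOne (fun _ => A * 1) ∈ gaussianClass γ L)
    (hbump : ∀ h z : ℝ, 0 < h → h ≤ 1 → rankOne (bumpProfile A γ h z) ∈ gaussianClass γ L)
    (G : Estimator n p) :
    ENNReal.ofReal (A ^ 2 * (2 * B) ^ (-γ) * (p : ℝ) ^ (-γ)) ≤ worstRisk γ L μ σ₀ x G := by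
  have hp' : (1 : ℝ) ≤ p := by exact_mod_cast hp
  set h : ℝ := (2 * B * p)⁻¹ with hh
  have h0 : 0 < h := by positivity
  have h1 : h ≤ 1 := inv_le_one_of_one_le₀ (by nlinarith)
  -- No design point meets the support of a bump of width `h` at `0`.
  have hzero : ∀ j, bumpProfile A γ h 0 (x j) = A * 1 := fun j => by
    rw [← sub_eq_zero, bumpProfile_sub, bump_rescale_eq_zero h0, mul_zero]
    rw [sub_zero, hh]
    refine le_trans ?_ (le_abs_self _)
    rw [inv_le_iff_one_le_mul₀ (by positivity)]
    linarith [hx j]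
  refine le_trans (ENNReal.ofReal_le_ofReal ?_)
    (worstRisk_ge_of_eq_on_design h₀ (hbump h 0 h0 h1) hzero 0 G)
  have hz := le_abs_bumpProfile_sq_sub (A := A) (γ := γ) h0 (0 : I)
  rw [Icc.coe_zero] at hz
  have hpow : h ^ γ = (2 * B) ^ (-γ) * (p : ℝ) ^ (-γ) := by
    rw [hh, Real.inv_rpow (by positivity), ← Real.rpow_neg (by positivity),
      Real.mul_rpow (by positivity) (by positivity)]
  rw [hpow] at hz
  linarith

/-- The error of the order `h ^ γ`, from about `1 / (2 * h)` disjoint bumps of width `h`. The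
bandwidth has to balance the height `h ^ γ` of a bump
against the information about it, of the order `n * p * h ^ (2 * γ + 1)`, which must not exceed the
logarithm of the number of bumps: `hinfo` and `hcount` compare both with `log ((n * p) ^ ρ)`. -/
theorem worstRisk_ge_bandwidth (hσ₀ : 0 < σ₀) (hn : 0 < n) (hp : 0 < p) (hA : 0 < A)
    (hB : 1 ≤ B) (hx : ∀ j j' : Fin p, |(j : ℝ) - (j' : ℝ)| ≤ p * B * |(x j : ℝ) - (x j' : ℝ)|)
    (h₀ : rankOne (fun _ => A * 1) ∈ gaussianClass γ L)
    (hbump : ∀ h z : ℝ, 0 < h → h ≤ 1 → rankOne (bumpProfile A γ h z) ∈ gaussianClass γ L)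
    {h ρ : ℝ} (h0 : 0 < h) (hph : 1 ≤ p * h) (hρ : 0 ≤ ρ)
    (hinfo : 2 * (A ^ 2 * (2 * B + 1)) / (σ₀ : ℝ) ^ 2 * (n * p * h ^ (2 * γ + 1)) ≤
      ρ * Real.log (n * p))
    (hcount : 4 * h * ((n : ℝ) * p) ^ ρ ≤ 1) (G : Estimator n p) :
    ENNReal.ofReal (A ^ 2 / 4 * h ^ γ) ≤ worstRisk γ L μ σ₀ x G := by
  have hN : (1 : ℝ) ≤ (n : ℝ) * p := by exact_mod_cast Nat.mul_pos hn hp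
  have hN1 : 1 ≤ ((n : ℝ) * p) ^ ρ := Real.one_le_rpow hN hρ
  have h4 : 4 * h ≤ 1 := by nlinarith
  set m := ⌊1 / (2 * h)⌋₊ with hm
  have hmle : (m : ℝ) * (2 * h) ≤ 1 := by
    rw [← le_div_iff₀ (by positivity)]
    exact Nat.floor_le (by positivity)
  have hmN : ((n : ℝ) * p) ^ ρ ≤ m := by
    have h1 := Nat.lt_floor_add_one (1 / (2 * h))
    rw [← hm, div_lt_iff₀ (by positivity)] at h1
    have h2 : 4 * h * ((n : ℝ) * p) ^ ρ < 4 * h * (m : ℝ) := by linarith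
    exact (lt_of_mul_lt_mul_left h2 (by positivity)).le
  have hm0 : 0 < m := by
    have : (0 : ℝ) < m := by linarith
    exact_mod_cast this
  have hzmem : ∀ k : Fin m, 2 * h * (k : ℝ) ∈ Icc (0 : ℝ) 1 := fun k => by
    have : (k : ℝ) ≤ m := by exact_mod_cast k.2.le
    exact ⟨by positivity, by nlinarith⟩
  set z : Fin m → I := fun k => ⟨2 * h * (k : ℝ), hzmem k⟩ with hz
  have hpow : h ^ (2 * γ + 1) = (h ^ γ) ^ 2 * h := by
    rw [Real.rpow_add h0, Real.rpow_one, mul_comm 2 γ, Real.rpow_mul h0.le, Real.rpow_two]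
  have hbd : ∀ t : ℝ, bump t ^ 2 ≤ 1 := fun t => pow_le_one₀ bump.nonneg bump.le_one
  -- A window of width `2 * h` holds at most `2 * p * B * h + 1` design points.
  have hcard : ∀ k : Fin m,
      ((Finset.univ.filter fun j => |(x j : ℝ) - z k| < h).card : ℝ) ≤ 2 * (p * B * h) + 1 := by
    refine fun k => card_le_of_abs_sub_le _ (by positivity) fun j hj j' hj' => ?_
    simp only [Finset.mem_filter, Finset.mem_univ, true_and] at hj hj'
    have habs : |(x j : ℝ) - x j'| ≤ 2 * h := by
      refine (abs_sub_le _ (z k : ℝ) _).trans ?_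
      rw [abs_sub_comm (z k : ℝ)]
      linarith
    calc _ ≤ p * B * |(x j : ℝ) - x j'| := hx j j'
      _ ≤ p * B * (2 * h) := by gcongr
      _ = _ := by ring
  have main := worstRisk_ge_of_shifts (μ := μ) (x := x) (L := L) (γ := γ)
    (g := fun k => bumpProfile A γ h (z k)) (δ := 2 * (A ^ 2 * h ^ γ))
    (S := A ^ 2 * (2 * B + 1) * (p * h ^ (2 * γ + 1))) hσ₀ hn hm0 h₀
    (fun k => hbump h (z k) h0 (by linarith)) z (by positivity)
    (fun k => le_abs_bumpProfile_sq_sub h0 (z k)) ?_ ?_ ?_ G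
  · refine le_trans (ENNReal.ofReal_le_ofReal (le_of_eq ?_)) main
    ring
  · intro k l hkl j
    rw [bumpProfile_sub, bumpProfile_sub]
    have hdist : 2 * h ≤ |(z k : ℝ) - z l| := by
      have h1 : (1 : ℝ) ≤ |(k : ℝ) - (l : ℝ)| := by
        have : (k : ℤ) - (l : ℤ) ≠ 0 := by
          rw [sub_ne_zero]
          exact_mod_cast Fin.val_ne_of_ne hkl
        exact_mod_cast Int.one_le_abs this
      have h2 : (z k : ℝ) - z l = 2 * h * ((k : ℝ) - (l : ℝ)) := by simp only [hz]; ring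
      rw [h2, abs_mul, abs_of_pos (by positivity)]
      nlinarith
    rcases le_or_gt h |(x j : ℝ) - z k| with h1 | h1
    · rw [bump_rescale_eq_zero h0 h1]; ring
    · rw [bump_rescale_eq_zero (z := z l) h0]
      · ring
      · have h3 := abs_sub_le (z k : ℝ) (x j) (z l)
        rw [abs_sub_comm (z k : ℝ) (x j)] at h3
        linarith
  · intro k
    calc ∑ j, (bumpProfile A γ h (z k) (x j) - A * 1) ^ 2
        ≤ ∑ j, if |(x j : ℝ) - z k| < h then (A * h ^ γ) ^ 2 else 0 := by
          refine Finset.sum_le_sum fun j _ => ?_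
          rw [bumpProfile_sub]
          split_ifs with h1
          · rw [mul_pow]
            exact mul_le_of_le_one_right (sq_nonneg _) (hbd _)
          · rw [bump_rescale_eq_zero h0 (not_lt.1 h1)]; simp
      _ = (Finset.univ.filter fun j => |(x j : ℝ) - z k| < h).card * (A * h ^ γ) ^ 2 := by
          rw [← Finset.sum_filter, Finset.sum_const, nsmul_eq_mul]
      _ ≤ ((2 * B + 1) * (p * h)) * (A * h ^ γ) ^ 2 := by
          gcongr
          exact (hcard k).trans (by nlinarith)
      _ = _ := by rw [hpow]; ring
  · refine le_trans ?_ hmN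
    rw [Real.rpow_def_of_pos (by linarith : (0 : ℝ) < (n : ℝ) * p), mul_comm (Real.log _)]
    refine Real.exp_le_exp.2 (le_trans (le_of_eq ?_) hinfo)
    ring

end Bounds

/-- The bandwidth `(κ * log t / t) ^ (1 / (2 * γ + 1))` decays faster than
`t ^ (-1 / (2 * (2 * γ + 1)))`, so that the number of bumps exceeds a power of `t = n * p`. -/
theorem tendsto_bandwidth_mul_rpow {γ κ : ℝ} (hγ : 0 < γ) (hκ : 0 < κ) :
    Tendsto (fun t : ℝ => 4 * (κ * (Real.log t / t)) ^ (1 / (2 * γ + 1)) *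
      t ^ (1 / (2 * (2 * γ + 1)))) atTop (nhds 0) := by
  have ha : 0 < 1 / (2 * γ + 1) := by positivity
  have h1 : Tendsto (fun t : ℝ => Real.log t / t ^ (1 / 2 : ℝ)) atTop (nhds 0) :=
    (isLittleO_log_rpow_atTop (by norm_num)).tendsto_div_nhds_zero
  have h2 := ((h1.const_mul κ).rpow_const (p := 1 / (2 * γ + 1)) (Or.inr ha.le)).const_mul 4
  rw [mul_zero, Real.zero_rpow ha.ne', mul_zero] at h2
  refine h2.congr' ?_
  filter_upwards [eventually_ge_atTop 1] with t ht
  have ht0 : 0 < t := by linarith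
  have hlog := Real.log_nonneg ht
  have h3 : t ^ (1 / (2 * (2 * γ + 1))) = (t ^ (1 / 2 : ℝ)) ^ (1 / (2 * γ + 1)) := by
    rw [← Real.rpow_mul ht0.le]
    congr 1
    field_simp
  have h4 : t ^ (1 / 2 : ℝ) * t ^ (1 / 2 : ℝ) = t := by
    rw [← Real.rpow_add ht0]; norm_num
  rw [h3, mul_assoc 4, ← Real.mul_rpow (by positivity) (by positivity)]
  congr 2
  have h5 : 0 < t ^ (1 / 2 : ℝ) := by positivity
  rw [mul_assoc κ]
  congr 1
  rw [div_mul_eq_mul_div, div_eq_div_iff h5.ne' ht0.ne', mul_assoc (Real.log t), h4]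

end CovKernel

theorem theorem2 (γ L : ℝ) (hγ : 0 < γ) (hL : 0 < L) (σ₀ : ℝ≥0) (hσ₀ : 0 < σ₀)
    (μ : I → ℝ) (f : ℝ → ℝ) (hf : CovKernel.IsDesignDensity f)
    (x : (p : ℕ) → Fin p → I) (hx : ∀ p, CovKernel.IsDesign f (x p)) :
    0 < Filter.liminf
      (fun q : ℕ × ℕ =>
        ⨅ G : CovKernel.Estimator q.1 q.2, ⨆ X ∈ CovKernel.gaussianClass γ L,
          ENNReal.ofReal (CovKernel.rate γ q.1 q.2)⁻¹ * CovKernel.risk μ σ₀ (x q.2) G X)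
      (Filter.atTop ×ˢ Filter.atTop) := by
  obtain ⟨A, hA, hbump, hconst⟩ := CovKernel.exists_amplitude hγ hL
  obtain ⟨B, hB, hspace⟩ := hf.exists_spacing
  have h₀ := hconst 1 zero_le_one le_rfl
  have hσ : (0 : ℝ) < (σ₀ : ℝ) := by exact_mod_cast hσ₀
  set ρ : ℝ := 1 / (2 * (2 * γ + 1)) with hρ
  set κ : ℝ := ρ * (σ₀ : ℝ) ^ 2 / (2 * (A ^ 2 * (2 * B + 1))) with hκ
  have hρ0 : 0 < ρ := by positivity
  have hκ0 : 0 < κ := by positivity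
  set cd : ℝ := A ^ 2 * (2 * B) ^ (-γ) with hcd
  set c : ℝ := min (A ^ 2 / 8) (min cd (min (A ^ 2 / 4) cd * κ ^ (γ / (2 * γ + 1)))) with hc
  have hcd0 : 0 < cd := by positivity
  have hmin0 : 0 < min (A ^ 2 / 4) cd := lt_min (by positivity) hcd0
  have hc0 : 0 < c := lt_min (by positivity) (lt_min hcd0 (by positivity))
  have hev : ∀ᶠ q : ℕ × ℕ in atTop ×ˢ atTop, 0 < q.1 ∧ 0 < q.2 ∧ 2 ≤ (q.1 : ℝ) * q.2 ∧
      4 * (κ * (Real.log ((q.1 : ℝ) * q.2) / ((q.1 : ℝ) * q.2))) ^ (1 / (2 * γ + 1)) *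
        ((q.1 : ℝ) * q.2) ^ ρ ≤ 1 := by
    have hN : Tendsto (fun q : ℕ × ℕ => (q.1 : ℝ) * q.2) (atTop ×ˢ atTop) atTop :=
      (tendsto_natCast_atTop_atTop.comp tendsto_fst).atTop_mul_atTop₀
        (tendsto_natCast_atTop_atTop.comp tendsto_snd)
    exact (tendsto_fst.eventually (eventually_gt_atTop 0)).and
      ((tendsto_snd.eventually (eventually_gt_atTop 0)).and
      ((hN.eventually_ge_atTop 2).and (hN.eventually
        ((CovKernel.tendsto_bandwidth_mul_rpow hγ hκ0).eventually_le_const one_pos))))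
  refine lt_of_lt_of_le (ENNReal.ofReal_pos.2 (by positivity : 0 < c / 3))
    (le_liminf_of_le (by isBoundedDefault) ?_)
  filter_upwards [hev] with q hq
  obtain ⟨n, p⟩ := q
  obtain ⟨hn, hp, hN2, hbw⟩ := hq
  simp only at hn hp hN2 hbw ⊢
  refine le_iInf fun G => ?_
  simp_rw [← ENNReal.mul_iSup]
  change _ ≤ _ * CovKernel.worstRisk γ L μ σ₀ (x p) G
  set W := CovKernel.worstRisk γ L μ σ₀ (x p) G with hW
  have hn' : (0 : ℝ) < n := by exact_mod_cast hn
  have hp' : (0 : ℝ) < p := by exact_mod_cast hp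
  set N : ℝ := (n : ℝ) * p with hN
  have hlog : 0 < Real.log N := Real.log_pos (by linarith)
  have hN0 : 0 < N := by positivity
  set h : ℝ := (κ * (Real.log N / N)) ^ (1 / (2 * γ + 1)) with hh
  have hh0 : 0 < h := by positivity
  have hhγ : h ^ γ = κ ^ (γ / (2 * γ + 1)) * (Real.log N / N) ^ (γ / (2 * γ + 1)) := by
    rw [hh, ← Real.rpow_mul (by positivity), one_div_mul_eq_div,
      Real.mul_rpow hκ0.le (by positivity)]
  have hh1 : h ^ (2 * γ + 1) = κ * (Real.log N / N) := by
    rw [hh, ← Real.rpow_mul (by positivity), one_div_mul_cancel (by positivity), Real.rpow_one]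
  have b₁ := CovKernel.worstRisk_ge_sampling (μ := μ) (σ₀ := σ₀) (x := x p) hn hconst G
  have b₂ := CovKernel.worstRisk_ge_discretization (n := n) (μ := μ) (σ₀ := σ₀) hp hB
    (hspace p (x p) (hx p)).1 h₀ hbump G
  -- If the bandwidth is below the resolution of the design, the discretization bound is larger.
  have b₃ : ENNReal.ofReal (min (A ^ 2 / 4) cd * h ^ γ) ≤ W := by
    rcases le_total 1 (p * h) with hph | hph
    · refine le_trans (ENNReal.ofReal_le_ofReal ?_) (CovKernel.worstRisk_ge_bandwidth (μ := μ)
        hσ₀ hn hp hA hB (hspace p (x p) (hx p)).2 h₀ hbump hh0 hph hρ0.le ?_ hbw G)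
      · gcongr
        exact min_le_left _ _
      · refine le_of_eq ?_
        rw [hh1, ← hN, hκ]
        field_simp
    · refine le_trans (ENNReal.ofReal_le_ofReal ?_) b₂
      have hle : h ^ γ ≤ (p : ℝ) ^ (-γ) := by
        rw [Real.rpow_neg hp'.le, ← Real.inv_rpow hp'.le]
        refine Real.rpow_le_rpow hh0.le ?_ hγ.le
        rw [← one_div, le_div_iff₀ hp', mul_comm]
        exact hph
      gcongr
      exact min_le_right _ _
  rw [hhγ, ← mul_assoc] at b₃
  set r₁ : ℝ := (n : ℝ) ^ (-(1 / 2) : ℝ) with hr₁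
  set r₂ : ℝ := (p : ℝ) ^ (-γ) with hr₂
  set r₃ : ℝ := (Real.log N / N) ^ (γ / (2 * γ + 1)) with hr₃
  have hr₁0 : 0 < r₁ := by positivity
  have hr₂0 : 0 < r₂ := by positivity
  have hr₃0 : 0 < r₃ := by positivity
  have hrate : CovKernel.rate γ n p = r₂ + r₃ + r₁ := rfl
  have hrate0 : 0 < CovKernel.rate γ n p := by rw [hrate]; positivity
  have key : ENNReal.ofReal (c / 3 * CovKernel.rate γ n p) ≤ W := by
    have w₁ : ENNReal.ofReal (c * r₁) ≤ W := le_trans (ENNReal.ofReal_le_ofReal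
      (mul_le_mul_of_nonneg_right (min_le_left _ _) hr₁0.le)) b₁
    have w₂ : ENNReal.ofReal (c * r₂) ≤ W := le_trans (ENNReal.ofReal_le_ofReal
      (mul_le_mul_of_nonneg_right ((min_le_right _ _).trans (min_le_left _ _)) hr₂0.le)) b₂
    have w₃ : ENNReal.ofReal (c * r₃) ≤ W := le_trans (ENNReal.ofReal_le_ofReal
      (mul_le_mul_of_nonneg_right ((min_le_right _ _).trans (min_le_right _ _)) hr₃0.le)) b₃
    have hmax : c / 3 * CovKernel.rate γ n p ≤ max (c * r₁) (max (c * r₂) (c * r₃)) := by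
      rw [hrate]
      linarith [le_max_left (c * r₁) (max (c * r₂) (c * r₃)),
        (le_max_left (c * r₂) (c * r₃)).trans (le_max_right (c * r₁) _),
        (le_max_right (c * r₂) (c * r₃)).trans (le_max_right (c * r₁) _)]
    refine (ENNReal.ofReal_le_ofReal hmax).trans ?_
    rw [ENNReal.ofReal_max, ENNReal.ofReal_max]
    exact max_le w₁ (max_le w₂ w₃)
  calc ENNReal.ofReal (c / 3)
      = ENNReal.ofReal (CovKernel.rate γ n p)⁻¹ *
          ENNReal.ofReal (c / 3 * CovKernel.rate γ n p) := by
        rw [← ENNReal.ofReal_mul (by positivity)]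
        congr 1
        field_simp
    _ ≤ _ := mul_le_mul_right key _
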